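/- Let $k$ be a field. For a finite quiver $Q$ (finitely many vertices and arrows; loops and multiple arrows are allowed), let $kQ$ be its path algebra: it has as $k$-basis the finite paths in $Q$, including the trivial path at each vertex; the product $pq$ of two paths is "$p$ followed by $q$" if $p$ ends where $q$ begins, and $0$ otherwise. It is $\mathbb N$-graded by path length. For an $\mathbb N$-graded $k$-algebra $A$, let $\mathsf{Gr}\,A$ be the category of $\mathbb Z$-graded right $A$-modules with degree-preserving homomorphisms, $\mathsf{Fdim}\,A$ its full subcategory of the modules that are the sum of their finite-dimensional submodules, and $\mathsf{QGr}\,A=\mathsf{Gr}\,A/\mathsf{Fdim}\,A$ the quotient category, i.e. the localization of $\mathsf{Gr}\,A$ at the morphisms whose kernel and cokernel belong to $\mathsf{Fdim}\,A$. **Theorem 1.1.** Let $Q'$ be a finite quiver, let $p_1,\dots,p_r$ be finitely many paths in $Q'$, and let $A=kQ'/(p_1,\dots,p_r)$ be the quotient of the path algebra by the two-sided ideal that they generate, graded by path length. (Equivalently, $A=T_KV/(p_1,\dots,p_r)$, where $K$ is a finite product of copies of $k$, $V$ is a finite-dimensional $K$-bimodule on which $k$ acts centrally, with a $k$-basis each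 of whose elements lies in some $e_iVe_j$ for the primitive idempotents $e_i$ of $K$, and each $p_j$ is a word in this basis.) Then there are a finite quiver $Q$ and an equivalence of categories $$\mathsf{QGr}\,A\;\equiv\;\mathsf{QGr}\,kQ .$$ -/

import Mathlib

open CategoryTheory

universe t w v u

noncomputable section

/-! ## Path algebras of quivers and their monomial quotients -/

section PathAlgebra

/-- The (finite, directed) paths of a quiver, including the trivial path `Quiver.Path.nil` at each
vertex. -/
abbrev QuiverPath (V : Type v) [Quiver.{w} V] : Type (max v w) :=
  Σ a b : V, Quiver.Path a b

/-- The path algebra `kQ`: the `k`-vector space with basis the paths of the quiver. -/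
def PathAlgebra (k : Type u) [Field k] (V : Type v) [Quiver.{w} V] : Type (max u v w) :=
  QuiverPath V →₀ k

namespace PathAlgebra

variable (k : Type u) [Field k] {V : Type v} [Quiver.{w} V]

instance : AddCommGroup (PathAlgebra k V) := inferInstanceAs (AddCommGroup (QuiverPath V →₀ k))

instance : Module k (PathAlgebra k V) := inferInstanceAs (Module k (QuiverPath V →₀ k))

/-- The basis element of `kQ` given by a path. -/
def ofPath (p : QuiverPath V) : PathAlgebra k V := Finsupp.single p 1

/-- The paths as a basis of `kQ`. -/
def pathBasis : Module.Basis (QuiverPath V) k (PathAlgebra k V) :=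
  Module.Basis.ofRepr (LinearEquiv.refl k (QuiverPath V →₀ k))

theorem pathBasis_apply (p : QuiverPath V) : pathBasis k p = ofPath k p := rfl

open Classical in
/-- The product of two paths: `p` followed by `q` if `p` ends where `q` begins, and `0` otherwise. -/
def pathMul : QuiverPath V → QuiverPath V → PathAlgebra k V
  | ⟨a, b, p⟩, ⟨c, d, q⟩ =>
    if h : b = c then ofPath k ⟨a, d, p.comp (q.cast h.symm rfl)⟩ else 0

/-- The bilinear extension of the product of paths. -/
def mulLin : PathAlgebra k V →ₗ[k] PathAlgebra k V →ₗ[k] PathAlgebra k V :=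
  (pathBasis k).constr k fun p => (pathBasis k).constr k fun q => pathMul k p q

instance : Mul (PathAlgebra k V) := ⟨fun x y => mulLin k x y⟩

theorem mul_def (x y : PathAlgebra k V) : x * y = mulLin k x y := rfl

theorem ofPath_mul_ofPath (p q : QuiverPath V) : ofPath k p * ofPath k q = pathMul k p q := by
  rw [mul_def, ← pathBasis_apply, ← pathBasis_apply, mulLin, Module.Basis.constr_basis,
    Module.Basis.constr_basis]

theorem ofPath_mul_ofPath_comp {a b c : V} (p : Quiver.Path a b) (q : Quiver.Path b c) :
    ofPath k ⟨a, b, p⟩ * ofPath k ⟨b, c, q⟩ = ofPath k ⟨a, c, p.comp q⟩ := by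
  rw [ofPath_mul_ofPath, pathMul, dif_pos rfl]; rfl

theorem ofPath_mul_ofPath_of_ne {a b c d : V} (p : Quiver.Path a b) (q : Quiver.Path c d)
    (h : b ≠ c) : ofPath k ⟨a, b, p⟩ * ofPath k ⟨c, d, q⟩ = 0 := by
  rw [ofPath_mul_ofPath, pathMul, dif_neg h]

@[elab_as_elim]
theorem induction_on {motive : PathAlgebra k V → Prop} (x : PathAlgebra k V) (zero : motive 0)
    (add : ∀ x y, motive x → motive y → motive (x + y))
    (smul_ofPath : ∀ (c : k) (p : QuiverPath V), motive (c • ofPath k p)) : motive x := by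
  have hx : x ∈ Submodule.span k (Set.range (pathBasis k (V := V))) := by
    rw [(pathBasis k).span_eq]; trivial
  induction hx using Submodule.span_induction with
  | mem x h => obtain ⟨p, rfl⟩ := h; simpa using! smul_ofPath 1 p
  | zero => exact zero
  | add x y _ _ hx hy => exact add x y hx hy
  | smul c x hx h =>
    clear h
    induction hx using Submodule.span_induction generalizing c with
    | mem x h => obtain ⟨p, rfl⟩ := h; exact smul_ofPath c p
    | zero => simpa using zero
    | add x y _ _ hx hy => rw [smul_add]; exact add _ _ (hx c) (hy c)
    | smul d x _ h => rw [smul_smul]; exact h (c * d)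

theorem mulLin_assoc (x y z : PathAlgebra k V) :
    mulLin k (mulLin k x y) z = mulLin k x (mulLin k y z) := by
  have key : ∀ p q r : QuiverPath V, mulLin k (mulLin k (ofPath k p) (ofPath k q)) (ofPath k r) =
      mulLin k (ofPath k p) (mulLin k (ofPath k q) (ofPath k r)) := by
    rintro ⟨a, b, p⟩ ⟨c, d, q⟩ ⟨e, f, r⟩
    simp only [← mul_def]
    by_cases h : b = c
    · subst h
      rw [ofPath_mul_ofPath_comp]
      by_cases h' : d = e
      · subst h'
        rw [ofPath_mul_ofPath_comp, ofPath_mul_ofPath_comp, ofPath_mul_ofPath_comp,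
          Quiver.Path.comp_assoc]
      · rw [ofPath_mul_ofPath_of_ne k _ _ h', ofPath_mul_ofPath_of_ne k _ _ h', mul_def k _ 0,
          map_zero]
    · rw [ofPath_mul_ofPath_of_ne k _ _ h, mul_def k 0, map_zero, LinearMap.zero_apply]
      by_cases h' : d = e
      · subst h'
        rw [ofPath_mul_ofPath_comp, ofPath_mul_ofPath_of_ne k _ _ h]
      · rw [ofPath_mul_ofPath_of_ne k _ _ h', mul_def k _ 0, map_zero]
  induction x using induction_on with
  | zero => simp
  | add x x' hx hx' => simp [hx, hx']
  | smul_ofPath c p =>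
    induction y using induction_on with
    | zero => simp
    | add y y' hy hy' =>
      simp only [map_add, LinearMap.add_apply, hy, hy']
    | smul_ofPath d q =>
      induction z using induction_on with
      | zero => simp
      | add z z' hz hz' => simp only [map_add, hz, hz']
      | smul_ofPath e r => simp only [map_smul, LinearMap.smul_apply, key]

/-- The identity of `kQ`: the sum of the trivial paths. -/
def unit (V : Type v) [Quiver.{w} V] [Finite V] : PathAlgebra k V :=
  ∑ᶠ a : V, ofPath k ⟨a, a, Quiver.Path.nil⟩

variable [Finite V]

theorem unit_mulLin (x : PathAlgebra k V) : mulLin k (unit k V) x = x := by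
  have := Fintype.ofFinite V
  induction x using induction_on with
  | zero => simp
  | add x y hx hy => rw [map_add, hx, hy]
  | smul_ofPath c p =>
    obtain ⟨a, b, p⟩ := p
    rw [map_smul, unit, finsum_eq_sum_of_fintype, map_sum, LinearMap.sum_apply,
      Finset.sum_eq_single a]
    · rw [← mul_def, ofPath_mul_ofPath_comp, Quiver.Path.nil_comp]
    · intro c _ h
      rw [← mul_def, ofPath_mul_ofPath_of_ne k _ _ h]
    · simp

theorem mulLin_unit (x : PathAlgebra k V) : mulLin k x (unit k V) = x := by
  have := Fintype.ofFinite V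
  induction x using induction_on with
  | zero => simp
  | add x y hx hy => rw [map_add, LinearMap.add_apply, hx, hy]
  | smul_ofPath c p =>
    obtain ⟨a, b, p⟩ := p
    rw [map_smul, LinearMap.smul_apply, unit, finsum_eq_sum_of_fintype, map_sum,
      Finset.sum_eq_single b]
    · rw [← mul_def, ofPath_mul_ofPath_comp, Quiver.Path.comp_nil]
    · intro c _ h
      rw [← mul_def, ofPath_mul_ofPath_of_ne k _ _ h.symm]
    · simp

instance : Ring (PathAlgebra k V) :=
  { (inferInstance : AddCommGroup (PathAlgebra k V)) with
    mul := fun x y => mulLin k x y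
    one := unit k V
    left_distrib := fun x y z => map_add (mulLin k x) y z
    right_distrib := fun x y z => by
      change mulLin k (x + y) z = mulLin k x z + mulLin k y z
      rw [map_add, LinearMap.add_apply]
    zero_mul := fun x => by change mulLin k 0 x = 0; rw [map_zero, LinearMap.zero_apply]
    mul_zero := fun x => map_zero (mulLin k x)
    mul_assoc := mulLin_assoc k
    one_mul := unit_mulLin k
    mul_one := mulLin_unit k }

theorem one_def : (1 : PathAlgebra k V) = ∑ᶠ a : V, ofPath k ⟨a, a, Quiver.Path.nil⟩ := rfl

instance : Algebra k (PathAlgebra k V) :=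
  Algebra.ofModule (fun r x y => by
      change mulLin k (r • x) y = r • mulLin k x y
      rw [map_smul, LinearMap.smul_apply])
    (fun r x y => map_smul (mulLin k x) r y)

/-- The grading of `kQ` by path length: the degree `n` part is spanned by the paths of length
`n`. -/
def grading (V : Type v) [Quiver.{w} V] [Finite V] (n : ℕ) : Submodule k (PathAlgebra k V) :=
  Submodule.span k (ofPath k '' {p | p.2.2.length = n})

variable {k} in
theorem ofPath_mem_grading (p : QuiverPath V) : ofPath k p ∈ grading k V p.2.2.length :=
  Submodule.subset_span ⟨p, rfl, rfl⟩

instance : SetLike.GradedMonoid (grading k V) where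
  one_mem := by
    have := Fintype.ofFinite V
    rw [one_def, finsum_eq_sum_of_fintype]
    exact Submodule.sum_mem _ fun a _ => ofPath_mem_grading (k := k) ⟨a, a, Quiver.Path.nil⟩
  mul_mem := by
    intro i j x y hx hy
    have h : grading k V i * grading k V j ≤ grading k V (i + j) := by
      rw [grading, grading, Submodule.span_mul_span, Submodule.span_le]
      rintro _ ⟨_, ⟨⟨a, b, p⟩, hp, rfl⟩, _, ⟨⟨c, d, q⟩, hq, rfl⟩, rfl⟩
      change p.length = i at hp
      change q.length = j at hq
      by_cases h : b = c
      · subst h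
        simp only [ofPath_mul_ofPath_comp]
        have := ofPath_mem_grading (k := k) ⟨a, d, p.comp q⟩
        simpa only [Quiver.Path.length_comp, hp, hq] using! this
      · simp only [ofPath_mul_ofPath_of_ne k _ _ h]
        exact Submodule.zero_mem _
    exact h (Submodule.mul_mem_mul hx hy)

open DirectSum in
/-- The decomposition of an element of `kQ` into homogeneous components. -/
def decomp (V : Type v) [Quiver.{w} V] [Finite V] :
    PathAlgebra k V →ₗ[k] ⨁ n, grading k V n :=
  (pathBasis k).constr k fun p => lof k ℕ (fun n => grading k V n) p.2.2.length
    ⟨ofPath k p, ofPath_mem_grading p⟩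

theorem decomp_ofPath (p : QuiverPath V) : decomp k V (ofPath k p) =
    DirectSum.lof k ℕ (fun n => grading k V n) p.2.2.length ⟨ofPath k p, ofPath_mem_grading p⟩ := by
  change decomp k V (pathBasis k p) = _
  rw [decomp, Module.Basis.constr_basis]

instance : DirectSum.Decomposition (grading k V) :=
  DirectSum.Decomposition.ofLinearMap _ (decomp k V)
    (by
      refine (pathBasis k).ext fun p => ?_
      rw [pathBasis_apply, LinearMap.comp_apply, decomp_ofPath, DirectSum.coeLinearMap_lof]
      rfl)
    (by
      refine DirectSum.linearMap_ext _ fun n => LinearMap.ext fun ⟨x, hx⟩ => ?_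
      simp only [LinearMap.comp_apply, DirectSum.coeLinearMap_lof, LinearMap.id_apply]
      induction hx using Submodule.span_induction with
      | mem x h =>
        obtain ⟨p, rfl, rfl⟩ := h
        exact decomp_ofPath k p
      | zero => rw [map_zero]; exact (map_zero _).symm
      | add x y hx hy h h' => rw [map_add, h, h', ← map_add]; rfl
      | smul c x hx h => rw [map_smul, h, ← map_smul]; rfl)

instance : GradedAlgebra (grading k V) where

end PathAlgebra

/-- The monomial algebra `kQ / I`, where `I` is the two-sided ideal generated by a set `F` of
paths. -/
abbrev MonomialAlgebra (k : Type u) [Field k] {V : Type v} [Quiver.{w} V] [Finite V]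
    (F : Set (QuiverPath V)) : Type (max u v w) :=
  (TwoSidedIdeal.span (PathAlgebra.ofPath k '' F)).ringCon.Quotient

namespace MonomialAlgebra

variable (k : Type u) [Field k] {V : Type v} [Quiver.{w} V] [Finite V] (F : Set (QuiverPath V))

/-- The quotient map `kQ → kQ / I`. -/
def mk : PathAlgebra k V →ₐ[k] MonomialAlgebra k F := RingCon.mkₐ k _

/-- The grading of `kQ / I` by path length: the degree `n` part is the image of the degree `n`
part of `kQ`. -/
def grading (n : ℕ) : Submodule k (MonomialAlgebra k F) :=
  (PathAlgebra.grading k V n).map (mk k F).toLinearMap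

instance : SetLike.GradedMonoid (grading k F) where
  one_mem := ⟨1, SetLike.GradedOne.one_mem, map_one (mk k F)⟩
  mul_mem := by
    rintro i j _ _ ⟨x, hx, rfl⟩ ⟨y, hy, rfl⟩
    exact ⟨x * y, SetLike.GradedMul.mul_mem hx hy, map_mul (mk k F) x y⟩

/-- The degree `n` part of the quotient map. -/
def mkDeg (n : ℕ) : PathAlgebra.grading k V n →ₗ[k] grading k F n :=
  (mk k F).toLinearMap.restrict fun x hx => ⟨x, hx, rfl⟩

open DirectSum in
theorem mkDeg_mul {i j : ℕ} (x : PathAlgebra.grading k V i) (y : PathAlgebra.grading k V j) :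
    (lof k ℕ (fun n => grading k F n) (i + j) ∘ₗ mkDeg k F (i + j))
        (GradedMonoid.GMul.mul (A := fun n => PathAlgebra.grading k V n) x y) =
      (lof k ℕ (fun n => grading k F n) i ∘ₗ mkDeg k F i) x *
      (lof k ℕ (fun n => grading k F n) j ∘ₗ mkDeg k F j) y := by
  simp only [LinearMap.comp_apply, lof_eq_of]
  rw [of_mul_of]
  exact congrArg _ (Subtype.ext (map_mul (mk k F) (x : PathAlgebra k V) y))

open DirectSum in
/-- The homomorphism `kQ → ⨁ₙ (kQ / I)ₙ` induced by the gradings. -/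
def preDecomp : PathAlgebra k V →ₐ[k] ⨁ n, grading k F n :=
  (toAlgebra k (fun n => PathAlgebra.grading k V n)
    (fun n => lof k ℕ (fun n => grading k F n) n ∘ₗ mkDeg k F n) rfl (mkDeg_mul k F)).comp
  (decomposeAlgEquiv (PathAlgebra.grading k V)).toAlgHom

theorem preDecomp_of_mem {n : ℕ} {x : PathAlgebra k V} (hx : x ∈ PathAlgebra.grading k V n) :
    preDecomp k F x =
      DirectSum.of (fun n => grading k F n) n ⟨mk k F x, ⟨x, hx, rfl⟩⟩ := by
  rw [preDecomp, AlgHom.comp_apply]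
  change DirectSum.toAlgebra k _ _ _ _ (DirectSum.decompose (PathAlgebra.grading k V) x) = _
  rw [DirectSum.decompose_of_mem _ hx]
  exact DirectSum.toSemiring_of _ rfl (mkDeg_mul k F) _ _

theorem preDecomp_ker : (TwoSidedIdeal.span (PathAlgebra.ofPath k '' F)).ringCon ≤
    RingCon.ker (preDecomp k F).toRingHom := by
  have h : TwoSidedIdeal.span (PathAlgebra.ofPath k '' F) ≤ TwoSidedIdeal.ker (preDecomp k F) := by
    rw [TwoSidedIdeal.span_le]
    rintro _ ⟨p, hp, rfl⟩
    rw [SetLike.mem_coe, TwoSidedIdeal.mem_ker,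
      preDecomp_of_mem k F (PathAlgebra.ofPath_mem_grading p)]
    have h0 : mk k F (PathAlgebra.ofPath k p) = 0 :=
      Quotient.sound' ((TwoSidedIdeal.mem_iff _ _).1 (TwoSidedIdeal.subset_span ⟨p, hp, rfl⟩))
    simp only [h0]
    exact map_zero _
  intro x y hxy
  have hxy' := h ((TwoSidedIdeal.rel_iff _ _ _).1 hxy)
  rw [TwoSidedIdeal.mem_ker, map_sub, sub_eq_zero] at hxy'
  exact hxy'

/-- The monomial algebra is graded by path length. -/
instance : GradedAlgebra (grading k F) :=
  GradedAlgebra.ofAlgHom (grading k F) (RingCon.liftₐ _ (preDecomp k F) (preDecomp_ker k F))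
    (by
      refine AlgHom.ext fun x => ?_
      obtain ⟨x, rfl⟩ := RingCon.mkₐ_surjective (α := k) _ x
      change DirectSum.coeAlgHom (grading k F) (preDecomp k F x) = mk k F x
      induction x using PathAlgebra.induction_on with
      | zero => simp
      | add x y hx hy => simp only [map_add, hx, hy]
      | smul_ofPath c p =>
        rw [map_smul, map_smul, preDecomp_of_mem k F (PathAlgebra.ofPath_mem_grading p),
          DirectSum.coeAlgHom_of, map_smul])
    (by
      rintro i ⟨_, x, hx, rfl⟩
      exact preDecomp_of_mem k F hx)

end MonomialAlgebra
end PathAlgebra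

/-! ## Graded modules and the quotient category -/

section GradedModules

open MulOpposite

/-- A `ℤ`-graded right module over an `ℕ`-graded `k`-algebra `A = ⨁ₙ 𝒜 n`. Right `A`-modules are
left modules over the opposite algebra: `m · a` is `op a • m`. -/
structure GrMod {k : Type u} [Field k] {A : Type v} [Ring A] [Algebra k A]
    (𝒜 : ℕ → Submodule k A) [GradedAlgebra 𝒜] where
  /-- The underlying type. -/
  carrier : Type t
  [addCommGroup : AddCommGroup carrier]
  /- The scalar tower forces this `k`-structure to be the one induced by `k → A`. -/
  [moduleBase : Module k carrier]
  [moduleOp : Module Aᵐᵒᵖ carrier]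
  [isScalarTower : IsScalarTower k Aᵐᵒᵖ carrier]
  /-- The homogeneous components. -/
  deg : ℤ → Submodule k carrier
  isInternal : DirectSum.IsInternal deg
  op_smul_mem : ∀ {i : ℤ} {n : ℕ} {m : carrier} {a : A}, m ∈ deg i → a ∈ 𝒜 n →
    op a • m ∈ deg (i + n)

namespace GrMod

attribute [instance] addCommGroup moduleBase moduleOp isScalarTower

variable {k : Type u} [Field k] {A : Type v} [Ring A] [Algebra k A]
  {𝒜 : ℕ → Submodule k A} [GradedAlgebra 𝒜]

/-- A morphism of graded right modules: an `A`-linear map that preserves degrees. -/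
@[ext]
structure Hom (M N : GrMod.{t} 𝒜) where
  /-- The underlying `A`-linear map. -/
  toLin : M.carrier →ₗ[Aᵐᵒᵖ] N.carrier
  map_deg : ∀ (i : ℤ) (m : M.carrier), m ∈ M.deg i → toLin m ∈ N.deg i

/-- The category `Gr A`. -/
instance : Category (GrMod.{t} 𝒜) where
  Hom M N := Hom M N
  id M := ⟨LinearMap.id, fun _ _ h => h⟩
  comp f g := ⟨g.toLin.comp f.toLin, fun i m h => g.map_deg i _ (f.map_deg i m h)⟩

theorem map_smul_base {M N : GrMod.{t} 𝒜} (f : M.carrier →ₗ[Aᵐᵒᵖ] N.carrier) (c : k)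
    (m : M.carrier) : f (c • m) = c • f m := by
  rw [← one_smul Aᵐᵒᵖ m, ← smul_assoc, map_smul, smul_assoc, one_smul, one_smul]

/-- The underlying `k`-linear map of a morphism. -/
def Hom.toLinBase {M N : GrMod.{t} 𝒜} (f : Hom M N) : M.carrier →ₗ[k] N.carrier where
  toFun := f.toLin
  map_add' := map_add f.toLin
  map_smul' := map_smul_base f.toLin

/-- The projection of a graded module to its degree `i` component. -/
def proj (M : GrMod.{t} 𝒜) (i : ℤ) : M.carrier →ₗ[k] M.carrier :=
  letI := M.isInternal.chooseDecomposition
  (M.deg i).subtype ∘ₗ DirectSum.component k ℤ (fun i => M.deg i) i ∘ₗ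
    (DirectSum.decomposeLinearEquiv M.deg).toLinearMap

theorem proj_apply (M : GrMod.{t} 𝒜) (i : ℤ) (x : M.carrier) :
    letI := M.isInternal.chooseDecomposition
    M.proj i x = DirectSum.decompose M.deg x i := rfl

theorem proj_mem (M : GrMod.{t} 𝒜) (i : ℤ) (x : M.carrier) : M.proj i x ∈ M.deg i := by
  rw [proj_apply]; exact Subtype.property _

theorem proj_of_mem {M : GrMod.{t} 𝒜} {i : ℤ} {x : M.carrier} (h : x ∈ M.deg i) :
    M.proj i x = x := by
  let := M.isInternal.chooseDecomposition
  rw [proj_apply, DirectSum.decompose_of_mem_same _ h]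

theorem proj_of_mem_ne {M : GrMod.{t} 𝒜} {i j : ℤ} {x : M.carrier} (h : x ∈ M.deg j)
    (hij : j ≠ i) : M.proj i x = 0 := by
  let := M.isInternal.chooseDecomposition
  rw [proj_apply, DirectSum.decompose_of_mem_ne _ h hij]

theorem mem_of_proj_mem (M : GrMod.{t} 𝒜) (P : Submodule k M.carrier) (x : M.carrier)
    (h : ∀ i, M.proj i x ∈ P) : x ∈ P := by
  classical
  let := M.isInternal.chooseDecomposition
  rw [← DirectSum.sum_support_decompose M.deg x]
  exact Submodule.sum_mem _ fun i _ => h i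

theorem proj_map {M N : GrMod.{t} 𝒜} (f : Hom M N) (i : ℤ) (x : M.carrier) :
    N.proj i (f.toLin x) = f.toLin (M.proj i x) := by
  let := M.isInternal.chooseDecomposition
  induction x using DirectSum.Decomposition.inductionOn M.deg with
  | zero => simp
  | @homogeneous j x =>
    by_cases h : j = i
    · subst h
      rw [proj_of_mem x.2, proj_of_mem (f.map_deg _ _ x.2)]
    · rw [proj_of_mem_ne x.2 h, proj_of_mem_ne (f.map_deg _ _ x.2) h, map_zero]
  | add x y hx hy => simp only [map_add, hx, hy]

theorem isInternal_of_proj {M P : Type t} [AddCommGroup M] [Module k M] [AddCommGroup P]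
    [Module k P] (p : ℤ → Submodule k M) (π : ℤ → M →ₗ[k] P)
    (h₁ : ∀ i, ∀ x ∈ p i, π i x = 0 → x = 0) (h₂ : ∀ i j, j ≠ i → ∀ x ∈ p j, π i x = 0)
    (h₃ : iSup p = ⊤) : DirectSum.IsInternal p := by
  rw [DirectSum.isInternal_submodule_iff_iSupIndep_and_iSup_eq_top]
  refine ⟨fun i => ?_, h₃⟩
  rw [Submodule.disjoint_def]
  intro x hx hx'
  have h : (⨆ (j) (_ : j ≠ i), p j) ≤ LinearMap.ker (π i) :=
    iSup₂_le fun j hj x hx => h₂ i j hj x hx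
  exact h₁ i x hx (h hx')

theorem isInternal_map {M P : Type t} [AddCommGroup M] [Module k M] [AddCommGroup P]
    [Module k P] (p : ℤ → Submodule k M) (π : ℤ → M →ₗ[k] M) (q : M →ₗ[k] P)
    (hq : Function.Surjective q) (hπ : ∀ i x, q x = 0 → q (π i x) = 0)
    (h₁ : ∀ i, ∀ x ∈ p i, π i x = x) (h₂ : ∀ i j, j ≠ i → ∀ x ∈ p j, π i x = 0)
    (h₃ : iSup p = ⊤) : DirectSum.IsInternal fun i => (p i).map q := by
  have hσ : ∀ i, ∃ σ : P →ₗ[k] P, ∀ x, σ (q x) = q (π i x) := fun i =>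
    ⟨((LinearMap.ker q).liftQ (q ∘ₗ π i) fun x hx => hπ i x hx) ∘ₗ
      (q.quotKerEquivOfSurjective hq).symm.toLinearMap, fun x => by
        have : (q.quotKerEquivOfSurjective hq).symm (q x) = Submodule.Quotient.mk x := by
          rw [LinearEquiv.symm_apply_eq]; rfl
        rw [LinearMap.comp_apply, LinearEquiv.coe_coe, this]; rfl⟩
  choose σ hσ using hσ
  refine isInternal_of_proj _ σ ?_ ?_ ?_
  · rintro i _ ⟨x, hx, rfl⟩ h
    rwa [hσ, h₁ i x hx] at h
  · rintro i j hij _ ⟨x, hx, rfl⟩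
    rw [hσ, h₂ i j hij x hx, map_zero]
  · rw [← Submodule.map_iSup, h₃, Submodule.map_top, LinearMap.range_eq_top.2 hq]

/-- The kernel of a morphism `f` in `Gr A`, with `(ker f)ᵢ = ker f ∩ Mᵢ`. -/
def ker {M N : GrMod.{t} 𝒜} (f : M ⟶ N) : GrMod.{t} 𝒜 where
  carrier := LinearMap.ker f.toLin
  deg i := (M.deg i).comap ((LinearMap.ker f.toLin).subtype.restrictScalars k)
  isInternal := by
    refine isInternal_of_proj _ (fun i => M.proj i ∘ₗ
      (LinearMap.ker f.toLin).subtype.restrictScalars k) ?_ ?_ ?_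
    · rintro i x hx h
      exact Subtype.ext ((proj_of_mem hx).symm.trans h)
    · rintro i j hij x hx
      exact proj_of_mem_ne hx hij
    · rw [eq_top_iff]
      rintro ⟨x, hx⟩ -
      have h : x ∈ (⨆ i, (M.deg i).comap
          ((LinearMap.ker f.toLin).subtype.restrictScalars k)).map
          ((LinearMap.ker f.toLin).subtype.restrictScalars k) := by
        refine M.mem_of_proj_mem _ x fun i => ?_
        have hi : f.toLin (M.proj i x) = 0 := by
          rw [← proj_map, LinearMap.mem_ker.1 hx, map_zero]
        exact ⟨⟨M.proj i x, hi⟩, Submodule.mem_iSup_of_mem i (M.proj_mem i x), rfl⟩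
      obtain ⟨y, hy, hyx⟩ := h
      have : y = ⟨x, hx⟩ := Subtype.ext hyx
      exact this ▸ hy
  op_smul_mem hm ha := M.op_smul_mem hm ha

/-- The projection of `N` to its quotient by the image of `f`, as a `k`-linear map. -/
def cokerProj {M N : GrMod.{t} 𝒜} (f : Hom M N) :
    N.carrier →ₗ[k] N.carrier ⧸ LinearMap.range f.toLin :=
  (LinearMap.range f.toLin).mkQ.restrictScalars k

theorem cokerProj_eq_zero {M N : GrMod.{t} 𝒜} (f : Hom M N) (x : N.carrier) :
    cokerProj f x = 0 ↔ ∃ y, f.toLin y = x :=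
  Submodule.Quotient.mk_eq_zero _

theorem isInternal_coker {M N : GrMod.{t} 𝒜} (f : Hom M N) :
    DirectSum.IsInternal fun i => (N.deg i).map (cokerProj f) := by
  refine isInternal_map N.deg N.proj (cokerProj f)
    (Submodule.mkQ_surjective (LinearMap.range f.toLin)) (fun i x hx => ?_)
    (fun i x hx => proj_of_mem hx) (fun i j hij x hx => proj_of_mem_ne hx hij)
    N.isInternal.submodule_iSup_eq_top
  obtain ⟨y, rfl⟩ := (cokerProj_eq_zero f x).1 hx
  exact (cokerProj_eq_zero f _).2 ⟨_, (proj_map f i y).symm⟩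

/-- The cokernel of a morphism `f : M ⟶ N` in `Gr A`: the quotient of `N` by the image of `f`, whose
degree `i` part is the image of `Nᵢ`. -/
def coker {M N : GrMod.{t} 𝒜} (f : M ⟶ N) : GrMod.{t} 𝒜 where
  carrier := N.carrier ⧸ LinearMap.range f.toLin
  deg i := (N.deg i).map (cokerProj f)
  isInternal := isInternal_coker f
  op_smul_mem := by
    rintro i n _ a ⟨m, hm, rfl⟩ ha
    exact ⟨op a • m, N.op_smul_mem hm ha, rfl⟩

end GrMod

variable {k : Type u} [Field k] {A : Type v} [Ring A] [Algebra k A]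
  (𝒜 : ℕ → Submodule k A) [GradedAlgebra 𝒜]

/-- `Fdim A`: the full subcategory of `Gr A` of the modules that are the sum of their
finite-dimensional submodules. (Asking for graded submodules gives the same modules: the
homogeneous components of the elements of a finite-dimensional submodule span a finite-dimensional
graded submodule.) -/
def Fdim : ObjectProperty (GrMod.{t} 𝒜) := fun M =>
  sSup {N : Submodule Aᵐᵒᵖ M.carrier | FiniteDimensional k N} = ⊤

/-- The morphisms of `Gr A` whose kernel and cokernel are in `Fdim A`. -/
def fdimIso : MorphismProperty (GrMod.{t} 𝒜) := fun _ _ f =>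
  Fdim 𝒜 (GrMod.ker f) ∧ Fdim 𝒜 (GrMod.coker f)

/-- `QGr A = Gr A / Fdim A`: the quotient of the abelian category `Gr A` by its subcategory `Fdim A`
(a Serre subcategory when `A` is finitely generated with `A₀` finite-dimensional, as it is for
monomial algebras of finite quivers), that is, the localization of `Gr A` at the morphisms whose
kernel and cokernel are in `Fdim A`. -/
abbrev QGr := (fdimIso.{t} 𝒜).Localization

end GradedModules
end

-- Let all relations have length at most `l + 1`. The quiver `Q` is the Ufnarovskii graph: its
-- vertices are the words `v` of length `l + 1` in the arrows of `Q'` that are nonzero in `A`, and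
-- its arrows `v ⟶ z` are the nonzero words of length `l + 2` that can be written both as `a z` and
-- as `v b`.
--
-- Reading first letters gives a graded homomorphism `φ : A → kQ` (`toPathAlgebra`), which sends `a`
-- to the sum of all arrows labelled `a`. It is well defined because the labels along a path of
-- length at most `l + 1` leaving `v` spell a prefix of `v` (`vertex_mul_wordProd_labelSum`), and a
-- relation is never a prefix of a nonzero word. Reading last letters gives a matrix representation
-- `ρ : kQ → Mat(A)` (`rep`). The equation `v b = a z` links the two: if `w` is the row vector of
-- all vertices, regarded as elements of `A`, then `a w = w ρ(φ a)` and `b φ(w) = φ(w ρ(b))`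
-- (`mul_word`, `mul_toPathAlgebra_word`).
--
-- Restriction along `φ` takes graded `kQ`-modules to graded `A`-modules. In the other direction `M`
-- goes to `⨁ᵥ M v`, a space of row vectors on which `kQ` acts through `ρ`. Multiplication by all
-- the words, `m ↦ (m v)ᵥ`, is a natural map from the identity to either composite. Over `A` its
-- kernel and cokernel are killed in degrees at least `l + 1`, since `Aᵢ` lies in `∑ᵥ v A` there.
-- Over `kQ` it is surjective, and its kernel is killed in the same degrees, since `kQᵢ` lies in the
-- span of `φ(Aᵢ) kQ`. Both functors preserve the morphisms with torsion kernel and cokernel, so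
-- they become mutually inverse after localization. Neither an adjunction nor a basis of `A` is
-- needed.

universe v'

set_option linter.unusedSectionVars false

noncomputable section

/-! ### Equivalences of localizations -/

namespace CategoryTheory.Localization

/-- Two functors that preserve the inverted morphisms, together with natural transformations from
the identities to their composites that are componentwise inverted, induce an equivalence of the
localizations. -/
theorem nonempty_equivalence_of_natTrans {C D : Type*} [Category* C] [Category* D]
    (W₁ : MorphismProperty C) (W₂ : MorphismProperty D) (F : C ⥤ D) (G : D ⥤ C)
    (hF : ∀ ⦃X Y : C⦄ (f : X ⟶ Y), W₁ f → W₂ (F.map f))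
    (hG : ∀ ⦃X Y : D⦄ (f : X ⟶ Y), W₂ f → W₁ (G.map f))
    (α : 𝟭 C ⟶ F ⋙ G) (hα : ∀ X, W₁ (α.app X))
    (β : 𝟭 D ⟶ G ⋙ F) (hβ : ∀ X, W₂ (β.app X)) :
    Nonempty (W₁.Localization ≌ W₂.Localization) := by
  have h₁ : W₁.IsInvertedBy (F ⋙ W₂.Q) := fun _ _ f hf => inverts W₂.Q W₂ _ (hF f hf)
  have h₂ : W₂.IsInvertedBy (G ⋙ W₁.Q) := fun _ _ f hf => inverts W₁.Q W₁ _ (hG f hf)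
  have i₁ : ∀ X, IsIso ((Functor.whiskerRight α W₁.Q).app X) := fun X =>
    inverts W₁.Q W₁ _ (hα X)
  have i₂ : ∀ X, IsIso ((Functor.whiskerRight β W₂.Q).app X) := fun X =>
    inverts W₂.Q W₂ _ (hβ X)
  have j₁ := NatIso.isIso_of_isIso_app (Functor.whiskerRight α W₁.Q)
  have j₂ := NatIso.isIso_of_isIso_app (Functor.whiskerRight β W₂.Q)
  exact ⟨equivalence W₁.Q W₁ W₂.Q W₂ (F ⋙ W₂.Q) (lift (F ⋙ W₂.Q) h₁ W₁.Q)
    (G ⋙ W₁.Q) (lift (G ⋙ W₁.Q) h₂ W₂.Q)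
    (Functor.associator _ _ _ ≪≫ Functor.isoWhiskerLeft F (fac (G ⋙ W₁.Q) h₂ W₂.Q) ≪≫
      (Functor.associator _ _ _).symm ≪≫ (asIso (Functor.whiskerRight α W₁.Q)).symm ≪≫
      Functor.leftUnitor _)
    (Functor.associator _ _ _ ≪≫ Functor.isoWhiskerLeft G (fac (F ⋙ W₂.Q) h₁ W₁.Q) ≪≫
      (Functor.associator _ _ _).symm ≪≫ (asIso (Functor.whiskerRight β W₂.Q)).symm ≪≫
      Functor.leftUnitor _)⟩

end CategoryTheory.Localization

/-! ### Torsion modules and the morphisms inverted in `QGr` -/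

namespace GrMod

open MulOpposite

variable {k : Type u} [Field k] {A : Type v} [Ring A] [Algebra k A]
  {𝒜 : ℕ → Submodule k A} [GradedAlgebra 𝒜]

theorem homogeneous_induction (M : GrMod.{t} 𝒜) {motive : M.carrier → Prop} (x : M.carrier)
    (zero : motive 0) (homogeneous : ∀ i, ∀ x ∈ M.deg i, motive x)
    (add : ∀ x y, motive x → motive y → motive (x + y)) : motive x := by
  let := M.isInternal.chooseDecomposition
  induction x using DirectSum.Decomposition.inductionOn M.deg with
  | zero => exact zero
  | homogeneous x => exact homogeneous _ x x.2
  | add x y hx hy => exact add x y hx hy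

theorem eq_zero_of_proj_eq_zero (M : GrMod.{t} 𝒜) (x : M.carrier) (h : ∀ i, M.proj i x = 0) :
    x = 0 := by
  simpa using M.mem_of_proj_mem ⊥ x fun i => by simp [h i]

theorem proj_op_smul (M : GrMod.{t} 𝒜) (i : ℤ) {n : ℕ} {a : A} (ha : a ∈ 𝒜 n) (x : M.carrier) :
    M.proj i (op a • x) = op a • M.proj (i - n) x := by
  induction x using M.homogeneous_induction with
  | zero => simp
  | homogeneous j x hx =>
    by_cases h : j = i - n
    · subst h
      rw [proj_of_mem hx, proj_of_mem]
      simpa using M.op_smul_mem hx ha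
    · rw [proj_of_mem_ne hx h, smul_zero, proj_of_mem_ne (M.op_smul_mem hx ha) (by omega)]
  | add x y hx hy => simp only [smul_add, map_add, hx, hy]

theorem exists_proj_eq_zero_of_lt (M : GrMod.{t} 𝒜) (x : M.carrier) :
    ∃ d : ℤ, ∀ i < d, M.proj i x = 0 := by
  induction x using M.homogeneous_induction with
  | zero => exact ⟨0, by simp⟩
  | homogeneous j x hx => exact ⟨j, fun i hi => proj_of_mem_ne hx (by omega)⟩
  | add x y hx hy =>
    obtain ⟨d, hd⟩ := hx
    obtain ⟨d', hd'⟩ := hy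
    exact ⟨min d d', fun i hi => by rw [map_add, hd i (by omega), hd' i (by omega), add_zero]⟩

theorem exists_proj_eq_zero_of_gt (M : GrMod.{t} 𝒜) (x : M.carrier) :
    ∃ d : ℤ, ∀ i > d, M.proj i x = 0 := by
  induction x using M.homogeneous_induction with
  | zero => exact ⟨0, by simp⟩
  | homogeneous j x hx => exact ⟨j, fun i hi => proj_of_mem_ne hx (by omega)⟩
  | add x y hx hy =>
    obtain ⟨d, hd⟩ := hx
    obtain ⟨d', hd'⟩ := hy
    exact ⟨max d d', fun i hi => by rw [map_add, hd i (by omega), hd' i (by omega), add_zero]⟩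

theorem exists_proj_eq_zero_of_fg (M : GrMod.{t} 𝒜) (P : Submodule k M.carrier) (hP : P.FG) :
    ∃ d : ℤ, ∀ i > d, P ≤ LinearMap.ker (M.proj i) := by
  induction P, hP using Submodule.fg_induction with
  | singleton x =>
    obtain ⟨d, hd⟩ := M.exists_proj_eq_zero_of_gt x
    refine ⟨d, fun i hi => ?_⟩
    rw [Submodule.span_le, Set.singleton_subset_iff]
    exact hd i hi
  | sup P P' _ _ h h' =>
    obtain ⟨d, hd⟩ := h
    obtain ⟨d', hd'⟩ := h'
    exact ⟨max d d', fun i hi => sup_le (hd i (by omega)) (hd' i (by omega))⟩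

/-- Every element is annihilated by all homogeneous elements of large degree. -/
def IsTorsion (M : GrMod.{t} 𝒜) : Prop :=
  ∀ m : M.carrier, ∃ n : ℕ, ∀ i ≥ n, ∀ a ∈ 𝒜 i, op a • m = 0

/-- A finite-dimensional submodule, graded or not, lives in degrees bounded above, while
multiplication by elements of large degree pushes every component of `m` beyond that bound. -/
theorem isTorsion_of_fdim {M : GrMod.{t} 𝒜} (hM : Fdim 𝒜 M) : M.IsTorsion := by
  intro m
  have hm : m ∈ sSup {N : Submodule Aᵐᵒᵖ M.carrier | FiniteDimensional k N} := by
    rw [show sSup _ = ⊤ from hM]; trivial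
  rw [sSup_eq_iSup'] at hm
  refine Submodule.iSup_induction _
    (motive := fun m => ∃ n : ℕ, ∀ i ≥ n, ∀ a ∈ 𝒜 i, op a • m = 0) hm
    (fun N m hm => ?_) ⟨0, by simp⟩ fun x y hx hy => ?_
  · obtain ⟨N, hN⟩ := N
    obtain ⟨d, hd⟩ := M.exists_proj_eq_zero_of_fg (N.restrictScalars k)
      (Module.Finite.iff_fg.1 hN)
    obtain ⟨c, hc⟩ := M.exists_proj_eq_zero_of_lt m
    -- The submodule has no components above `d` and `m` has none below `c`, so `m · a` could only
    -- have components in degrees at least `c + i > d`.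
    refine ⟨(d + 1 - c).toNat, fun i hi a ha => M.eq_zero_of_proj_eq_zero _ fun j => ?_⟩
    by_cases hj : j > d
    · exact hd j hj (N.smul_mem (op a) hm)
    · rw [M.proj_op_smul j ha, hc _ (by omega), smul_zero]
  · obtain ⟨n, hn⟩ := hx
    obtain ⟨n', hn'⟩ := hy
    refine ⟨max n n', fun i hi a ha => ?_⟩
    rw [smul_add, hn i (by omega) a ha, hn' i (by omega) a ha, add_zero]

/-- The `k`-linear map `a ↦ m · a`. -/
def actOn (M : GrMod.{t} 𝒜) (m : M.carrier) : A →ₗ[k] M.carrier where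
  toFun a := op a • m
  map_add' a b := by rw [MulOpposite.op_add, add_smul]
  map_smul' c a := by rw [MulOpposite.op_smul, smul_assoc]; rfl

/-- The right action of an element, as a `k`-linear map `m ↦ m · a`. -/
def actBy (M : GrMod.{t} 𝒜) (a : A) : M.carrier →ₗ[k] M.carrier where
  toFun m := op a • m
  map_add' := smul_add _
  map_smul' c m := by
    rw [RingHom.id_apply, ← one_smul Aᵐᵒᵖ m, ← smul_assoc c, ← mul_smul, ← mul_smul, ← smul_assoc,
      mul_one, mul_smul_comm, mul_one]

/-- The cyclic submodule `m A` is a sum of finitely many spaces `m Aᵢ`, each finite-dimensional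
because `Aᵢ` is. -/
theorem fdim_of_isTorsion [∀ n, FiniteDimensional k (𝒜 n)] {M : GrMod.{t} 𝒜}
    (hM : M.IsTorsion) : Fdim 𝒜 M := by
  refine eq_top_iff.2 fun m _ => ?_
  have hfd : FiniteDimensional k (Submodule.span Aᵐᵒᵖ {m}) := by
    obtain ⟨n, hn⟩ := hM m
    let P : Submodule k M.carrier := (Finset.range n).sup fun i => (𝒜 i).map (M.actOn m)
    have hP : ∀ a, M.actOn m a ∈ P := by
      intro a
      induction a using DirectSum.Decomposition.inductionOn 𝒜 with
      | zero => simp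
      | @homogeneous i a =>
        by_cases h : i < n
        · exact Finset.le_sup (f := fun i => (𝒜 i).map (M.actOn m)) (Finset.mem_range.2 h)
            ⟨a, a.2, rfl⟩
        · rw [show M.actOn m (a : A) = 0 from hn i (by omega) a a.2]
          exact P.zero_mem
      | add a b ha hb => rw [map_add]; exact P.add_mem ha hb
    have hP' : (Submodule.span Aᵐᵒᵖ {m}).restrictScalars k ≤ P := by
      intro x hx
      obtain ⟨a, rfl⟩ := Submodule.mem_span_singleton.1 hx
      exact hP a.unop
    have : FiniteDimensional k P := Submodule.finiteDimensional_finset_sup _ _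
    exact Submodule.finiteDimensional_of_le hP'
  exact le_sSup (a := Submodule.span Aᵐᵒᵖ {m}) hfd (Submodule.mem_span_singleton_self m)

/-- This elementwise form is the one in which membership in `fdimIso` is checked for both functors
and both natural maps. -/
theorem fdimIso_iff [∀ n, FiniteDimensional k (𝒜 n)] {M N : GrMod.{t} 𝒜} (f : M ⟶ N) :
    fdimIso 𝒜 f ↔
      (∀ m, f.toLin m = 0 → ∃ n : ℕ, ∀ i ≥ n, ∀ a ∈ 𝒜 i, op a • m = 0) ∧
      ∀ y, ∃ n : ℕ, ∀ i ≥ n, ∀ a ∈ 𝒜 i, op a • y ∈ LinearMap.range f.toLin := by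
  have h : ∀ M : GrMod.{t} 𝒜, Fdim 𝒜 M ↔ M.IsTorsion := fun M =>
    ⟨isTorsion_of_fdim, fdim_of_isTorsion⟩
  refine and_congr ((h _).trans ⟨fun H m hm => ?_, fun H m => ?_⟩)
    ((h _).trans ⟨fun H y => ?_, fun H y => ?_⟩)
  · obtain ⟨n, hn⟩ := H ⟨m, hm⟩
    exact ⟨n, fun i hi a ha => congrArg Subtype.val (hn i hi a ha)⟩
  · obtain ⟨n, hn⟩ := H m.1 m.2
    exact ⟨n, fun i hi a ha => Subtype.ext (hn i hi a ha)⟩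
  · obtain ⟨n, hn⟩ := H (Submodule.Quotient.mk y)
    exact ⟨n, fun i hi a ha => (Submodule.Quotient.mk_eq_zero _).1 (hn i hi a ha)⟩
  · obtain ⟨y, rfl⟩ := Submodule.Quotient.mk_surjective _ y
    obtain ⟨n, hn⟩ := H y
    exact ⟨n, fun i hi a ha => (Submodule.Quotient.mk_eq_zero _).2 (hn i hi a ha)⟩

end GrMod

/-! ### Transfer between two graded algebras, up to torsion -/

section

open MulOpposite

variable {k : Type u} [Field k] {A : Type v} [Ring A] [Algebra k A]
  {𝒜 : ℕ → Submodule k A} [GradedAlgebra 𝒜] {B : Type v'} [Ring B] [Algebra k B]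
  {ℬ : ℕ → Submodule k B} [GradedAlgebra ℬ]

theorem Submodule.smul_add_mem {R M : Type*} [Semiring R] [AddCommMonoid M] [Module R M]
    (P : Submodule R M) (r : R) {x y : M} (hx : r • x ∈ P) (hy : r • y ∈ P) : r • (x + y) ∈ P := by
  rw [smul_add]; exact P.add_mem hx hy

namespace GrMod

/-- Restriction of scalars along a homomorphism of graded algebras. -/
def restrict (f : A →ₐ[k] B) (hf : ∀ {i a}, a ∈ 𝒜 i → f a ∈ ℬ i) :
    GrMod.{t} ℬ ⥤ GrMod.{t} 𝒜 where
  obj N :=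
    { carrier := N.carrier
      moduleOp := Module.compHom N.carrier f.toRingHom.op
      isScalarTower := by
        let : Module Aᵐᵒᵖ N.carrier := Module.compHom N.carrier f.toRingHom.op
        refine ⟨fun c a m => ?_⟩
        change op (f (c • a.unop)) • m = c • op (f a.unop) • m
        rw [map_smul, MulOpposite.op_smul, smul_assoc]
      deg := N.deg
      isInternal := N.isInternal
      op_smul_mem := fun hm ha => N.op_smul_mem hm (hf ha) }
  map g :=
    { toLin :=
        { toFun := g.toLin
          map_add' := map_add g.toLin
          map_smul' := fun a m => map_smul g.toLin (op (f a.unop)) m }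
      map_deg := g.map_deg }

theorem fdimIso_restrict_map [∀ n, FiniteDimensional k (𝒜 n)] [∀ n, FiniteDimensional k (ℬ n)]
    (f : A →ₐ[k] B) (hf : ∀ {i a}, a ∈ 𝒜 i → f a ∈ ℬ i) {M N : GrMod.{t} ℬ} (g : M ⟶ N)
    (hg : fdimIso ℬ g) : fdimIso 𝒜 ((restrict f hf).map g) := by
  rw [fdimIso_iff] at hg ⊢
  refine ⟨fun m hm => ?_, fun y => ?_⟩
  · obtain ⟨n, hn⟩ := hg.1 m hm
    exact ⟨n, fun i hi a ha => hn i hi (f a) (hf ha)⟩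
  · obtain ⟨n, hn⟩ := hg.2 y
    exact ⟨n, fun i hi a ha => hn i hi (f a) (hf ha)⟩

end GrMod

variable (𝒜 ℬ) in
/-- A homomorphism `map : A → B` of graded algebras together with a matrix representation `rep` of
`B` over `A` and homogeneous elements `word v` of `A` of the same degree that are compatible with
them in such a way that `M ↦ ⨁ᵥ M · word v` is an inverse, up to torsion, of the restriction
along `map`. -/
structure TransferDatum (W : Type w) [Fintype W] [DecidableEq W] where
  /-- The homomorphism along which modules are restricted. -/
  map : A →ₐ[k] B
  map_mem : ∀ {i a}, a ∈ 𝒜 i → map a ∈ ℬ i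
  /-- The matrix representation. -/
  rep : B →ₐ[k] Matrix W W A
  rep_mem : ∀ {i b}, b ∈ ℬ i → ∀ v z, rep b v z ∈ 𝒜 i
  /-- The common degree of the words. -/
  len : ℕ
  /-- The element of `A` attached to an index. -/
  word : W → A
  word_mem : ∀ v, word v ∈ 𝒜 len
  /-- The idempotent of `B` attached to an index. -/
  vertex : W → B
  vertex_mul_map_word : ∀ v z, vertex v * map (word z) = if v = z then map (word v) else 0
  rep_vertex : ∀ v, rep (vertex v) = Matrix.single v v 1
  -- This makes `⨁ᵥ M · word v` stable under the row action of `B`. The degree of `a` matters for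
  -- cokernels, where `a` has to become large together with `b`.
  word_mul_rep : ∀ {i b}, b ∈ ℬ i → ∀ v z, ∃ a ∈ 𝒜 i, word v * rep b v z = a * word z
  -- This identity and the next make `m ↦ (m · word v)ᵥ` linear, over `A` and over `B` respectively.
  mul_word : ∀ a z, a * word z = ∑ v, word v * rep (map a) v z
  mul_map_word : ∀ b z, b * map (word z) = ∑ v, map (word v * rep b v z)
  -- This condition and the next ensure that whatever is killed by all words is killed by every
  -- element of degree at least `len`, of `A` and of `B` respectively.
  exists_eq_sum : ∀ {i a}, len ≤ i → a ∈ 𝒜 i → ∃ c : W → A, a = ∑ v, word v * c v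
  mem_span : ∀ {i b}, b ∈ ℬ i → b ∈ Submodule.span k {x | ∃ a ∈ 𝒜 i, ∃ c, x = map a * c}

namespace TransferDatum

variable {W : Type} [Fintype W] [DecidableEq W] (T : TransferDatum 𝒜 ℬ W)

theorem exists_word_mul_rep (b : B) (v z : W) : ∃ a, T.word v * T.rep b v z = a * T.word z := by
  induction b using DirectSum.Decomposition.inductionOn ℬ with
  | zero => exact ⟨0, by simp⟩
  | homogeneous b =>
    obtain ⟨a, -, h⟩ := T.word_mul_rep b.2 v z
    exact ⟨a, h⟩
  | add b c hb hc =>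
    obtain ⟨a, ha⟩ := hb
    obtain ⟨a', ha'⟩ := hc
    exact ⟨a + a', by rw [map_add, Matrix.add_apply, mul_add, ha, ha', add_mul]⟩

/-- The `k`-module `⨁ᵥ M · word v`. -/
def family (M : GrMod.{t} 𝒜) : Submodule k (W → M.carrier) :=
  Submodule.pi Set.univ fun v => LinearMap.range (M.actBy (T.word v))

variable {T} in
theorem mem_family {M : GrMod.{t} 𝒜} {x : W → M.carrier} :
    x ∈ T.family M ↔ ∀ v, ∃ m, op (T.word v) • m = x v :=
  ⟨fun h v => h v trivial, fun h v _ => h v⟩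

/-- The right action of `B` on row vectors. -/
def rowAct (M : GrMod.{t} 𝒜) (b : B) (x : W → M.carrier) : W → M.carrier :=
  fun z => ∑ v, op (T.rep b v z) • x v

/-- Moving the matrix entry to the left of the word, `m · word v · rep b v z = m · a · word z`, puts
each summand back into `M · word z`. -/
theorem rowAct_mem {M : GrMod.{t} 𝒜} (b : B) {x : W → M.carrier} (hx : x ∈ T.family M) :
    T.rowAct M b x ∈ T.family M := by
  rw [mem_family] at hx ⊢
  intro z
  choose m hm using hx
  choose a ha using fun v => T.exists_word_mul_rep b v z
  refine ⟨∑ v, op (a v) • m v, ?_⟩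
  rw [rowAct, Finset.smul_sum]
  refine Finset.sum_congr rfl fun v _ => ?_
  rw [← hm, ← mul_smul, ← mul_smul, ← op_mul, ← op_mul, ha]

instance (M : GrMod.{t} 𝒜) : SMul Bᵐᵒᵖ (T.family M) :=
  ⟨fun b x => ⟨T.rowAct M b.unop x, T.rowAct_mem _ x.2⟩⟩

theorem op_smul_apply (M : GrMod.{t} 𝒜) (b : B) (x : T.family M) (z : W) :
    (op b • x : T.family M).1 z = ∑ v, op (T.rep b v z) • x.1 v := rfl

instance (M : GrMod.{t} 𝒜) : Module Bᵐᵒᵖ (T.family M) where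
  one_smul x := by
    refine Subtype.ext (funext fun z => ?_)
    rw [← op_one, op_smul_apply, map_one, Finset.sum_eq_single z]
    · simp
    · intro v _ h
      simp [Matrix.one_apply_ne h]
    · simp
  mul_smul b c x := by
    refine Subtype.ext (funext fun z => ?_)
    change ∑ v, op (T.rep (c.unop * b.unop) v z) • x.1 v =
      ∑ y, op (T.rep b.unop y z) • ∑ v, op (T.rep c.unop v y) • x.1 v
    simp only [map_mul, Matrix.mul_apply, Finset.smul_sum, Finset.op_sum, Finset.sum_smul, op_mul,
      mul_smul]
    exact Finset.sum_comm
  smul_zero b := by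
    refine Subtype.ext (funext fun z => ?_)
    exact Finset.sum_eq_zero fun v _ => smul_zero _
  smul_add b x y := by
    refine Subtype.ext (funext fun z => ?_)
    change ∑ v, op (T.rep b.unop v z) • (x.1 v + y.1 v) =
      ∑ v, op (T.rep b.unop v z) • x.1 v + ∑ v, op (T.rep b.unop v z) • y.1 v
    simp only [smul_add, Finset.sum_add_distrib]
  add_smul b c x := by
    refine Subtype.ext (funext fun z => ?_)
    change ∑ v, op (T.rep (b.unop + c.unop) v z) • x.1 v =
      ∑ v, op (T.rep b.unop v z) • x.1 v + ∑ v, op (T.rep c.unop v z) • x.1 v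
    simp only [map_add, Matrix.add_apply, MulOpposite.op_add, add_smul, Finset.sum_add_distrib]
  zero_smul x := by
    refine Subtype.ext (funext fun z => ?_)
    change ∑ v, op (T.rep (0 : B) v z) • x.1 v = 0
    simp

instance (M : GrMod.{t} 𝒜) : IsScalarTower k Bᵐᵒᵖ (T.family M) where
  smul_assoc c b x := by
    refine Subtype.ext (funext fun z => ?_)
    change ∑ v, op (T.rep (c • b.unop) v z) • x.1 v = c • ∑ v, op (T.rep b.unop v z) • x.1 v
    simp only [map_smul, Matrix.smul_apply, MulOpposite.op_smul, smul_assoc, Finset.smul_sum]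

/-- The vector with the single entry `m · word v`. -/
def single (M : GrMod.{t} 𝒜) (v : W) : M.carrier →ₗ[k] T.family M :=
  (LinearMap.single k (fun _ => M.carrier) v ∘ₗ M.actBy (T.word v)).codRestrict _ fun m => by
    rw [mem_family]
    intro z
    by_cases h : z = v
    · subst h
      exact ⟨m, by simp [GrMod.actBy]⟩
    · exact ⟨0, by simp [h]⟩

theorem single_same (M : GrMod.{t} 𝒜) (v : W) (m : M.carrier) :
    (T.single M v m).1 v = op (T.word v) • m := by
  simp [single, GrMod.actBy]

theorem single_ne (M : GrMod.{t} 𝒜) {v z : W} (h : z ≠ v) (m : M.carrier) :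
    (T.single M v m).1 z = 0 := by
  simp [single, h]

theorem op_smul_single (M : GrMod.{t} 𝒜) (b : B) (v z : W) (m : M.carrier) :
    (op b • T.single M v m).1 z = op (T.word v * T.rep b v z) • m := by
  rw [op_smul_apply, Finset.sum_eq_single v, single_same, ← mul_smul, op_mul]
  · intro y _ h
    rw [single_ne _ _ h, smul_zero]
  · simp

theorem sum_single_apply (M : GrMod.{t} 𝒜) (m : W → M.carrier) (z : W) :
    (∑ v, T.single M v (m v)).1 z = op (T.word z) • m z := by
  rw [AddSubmonoidClass.coe_finsetSum, Finset.sum_apply, Finset.sum_eq_single z, single_same]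
  · exact fun v _ h => single_ne _ _ h.symm _
  · simp

theorem exists_eq_sum_single {M : GrMod.{t} 𝒜} (x : T.family M) :
    ∃ m : W → M.carrier, x = ∑ v, T.single M v (m v) := by
  choose m hm using mem_family.1 x.2
  exact ⟨m, Subtype.ext (funext fun z => by rw [sum_single_apply, hm])⟩

/-- Cokernel conditions are additive in the vector, so it is enough to treat vectors with one entry,
where `op_smul_single` computes the action. -/
theorem family_induction {M : GrMod.{t} 𝒜} {motive : T.family M → Prop} (x : T.family M)
    (zero : motive 0) (single : ∀ v m, motive (T.single M v m))
    (add : ∀ x y, motive x → motive y → motive (x + y)) : motive x := by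
  obtain ⟨m, rfl⟩ := T.exists_eq_sum_single x
  exact Finset.sum_induction _ _ add zero fun v _ => single v _

/-- The graded `B`-module `⨁ᵥ M · word v`, with degrees shifted so that `m · word v` has the
degree of `m`. -/
def extendObj (M : GrMod.{t} 𝒜) : GrMod.{t} ℬ where
  carrier := T.family M
  deg i := (Submodule.pi Set.univ fun _ => M.deg (i + T.len)).comap (T.family M).subtype
  isInternal := by
    refine GrMod.isInternal_of_proj _
      (fun i => (LinearMap.pi fun v => M.proj (i + T.len) ∘ₗ LinearMap.proj v) ∘ₗ
        (T.family M).subtype) ?_ ?_ ?_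
    · intro i x hx h
      refine Subtype.ext (funext fun v => ?_)
      exact (GrMod.proj_of_mem (hx v trivial)).symm.trans (congrFun h v)
    · intro i j hij x hx
      exact funext fun v => GrMod.proj_of_mem_ne (hx v trivial) (by omega)
    · refine Submodule.eq_top_iff'.2 fun x => ?_
      induction x using T.family_induction with
      | zero => exact Submodule.zero_mem _
      | add x y hx hy => exact Submodule.add_mem _ hx hy
      | single v m =>
        induction m using M.homogeneous_induction with
        | zero => rw [map_zero]; exact Submodule.zero_mem _
        | add x y hx hy => rw [map_add]; exact Submodule.add_mem _ hx hy
        | homogeneous i m hm =>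
          refine Submodule.mem_iSup_of_mem i fun z _ => ?_
          by_cases h : z = v
          · subst h
            change (T.single M z m).1 z ∈ _
            rw [single_same]
            exact M.op_smul_mem hm (T.word_mem z)
          · change (T.single M v m).1 z ∈ _
            rw [single_ne _ _ h]
            exact Submodule.zero_mem _
  op_smul_mem := by
    intro i n x b hx hb z _
    refine Submodule.sum_mem _ fun v _ => ?_
    have := M.op_smul_mem (hx v trivial) (T.rep_mem hb v z)
    rwa [add_right_comm] at this

/-- The functor `M ↦ ⨁ᵥ M · word v`. -/
def extend : GrMod.{t} 𝒜 ⥤ GrMod.{t} ℬ where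
  obj M := T.extendObj M
  map {M N} g :=
    { toLin :=
        { toFun := fun x : T.family M => (⟨fun v => g.toLin (x.1 v), mem_family.2 fun v => by
            obtain ⟨m, hm⟩ := mem_family.1 x.2 v
            exact ⟨g.toLin m, by rw [← hm, map_smul]⟩⟩ : T.family N)
          map_add' := fun x y => Subtype.ext (funext fun v => map_add g.toLin (x.1 v) (y.1 v))
          map_smul' := fun b x => Subtype.ext (funext fun z => by
            change g.toLin (∑ v, op (T.rep b.unop v z) • x.1 v) =
              ∑ v, op (T.rep b.unop v z) • g.toLin (x.1 v)
            simp only [map_sum, map_smul]) }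
      map_deg := fun i x hx v hv => g.map_deg _ _ (hx v hv) }

/-- A vector in the kernel has finitely many entries, all in the kernel of `g`, so one bound serves
them all. For the cokernel, the entries of `(m · word v) · b` have the form `m · a · word z` with
`a` of the degree of `b`. In large degree `m · a` is in the image of `g`, and the factor `word z`
keeps the lift inside the family. -/
theorem fdimIso_extend_map [∀ n, FiniteDimensional k (𝒜 n)] [∀ n, FiniteDimensional k (ℬ n)]
    {M N : GrMod.{t} 𝒜} (g : M ⟶ N) (hg : fdimIso 𝒜 g) :
    fdimIso ℬ (T.extend.map g) := by
  rw [GrMod.fdimIso_iff] at hg ⊢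
  refine ⟨fun x hx => ?_, fun x => ?_⟩
  · choose n hn using fun v => hg.1 (x.1 v) (congrFun (congrArg Subtype.val hx) v)
    refine ⟨Finset.univ.sup n, fun i hi b hb => Subtype.ext (funext fun z => ?_)⟩
    exact Finset.sum_eq_zero fun v _ =>
      hn v i ((Finset.le_sup (Finset.mem_univ v)).trans hi) _ (T.rep_mem hb v z)
  · change T.family N at x
    induction x using T.family_induction with
    | zero => exact ⟨0, fun i _ b _ => ⟨0, by rw [map_zero]; exact (smul_zero _).symm⟩⟩
    | add x y hx hy =>
      obtain ⟨n, hn⟩ := hx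
      obtain ⟨n', hn'⟩ := hy
      refine ⟨max n n', fun i hi b hb => ?_⟩
      exact Submodule.smul_add_mem _ (op b) (hn i (by omega) b hb) (hn' i (by omega) b hb)
    | single v m =>
      obtain ⟨n, hn⟩ := hg.2 m
      refine ⟨n, fun i hi b hb => ?_⟩
      choose a ha hab using fun z => T.word_mul_rep hb v z
      choose m' hm' using fun z => hn i hi (a z) (ha z)
      refine ⟨∑ z, T.single M z (m' z), Subtype.ext (funext fun z => ?_)⟩
      refine Eq.trans ?_ (T.op_smul_single N b v z m).symm
      change g.toLin ((∑ z, T.single M z (m' z)).1 z) = _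
      rw [sum_single_apply, map_smul, hm', hab, op_mul, mul_smul]

/-- The natural homomorphism `m ↦ (m · word v)ᵥ`. -/
def toRestrictExtend :
    𝟭 (GrMod.{t} 𝒜) ⟶ T.extend ⋙ GrMod.restrict T.map T.map_mem where
  app M :=
    { toLin :=
        { toFun := fun m => (⟨fun v => op (T.word v) • m, mem_family.2 fun v => ⟨m, rfl⟩⟩ :
            T.family M)
          map_add' := fun x y => Subtype.ext (funext fun v => smul_add _ _ _)
          map_smul' := fun a m => Subtype.ext (funext fun z => by
            change op (T.word z) • op a.unop • m =
              ∑ v, op (T.rep (T.map a.unop) v z) • op (T.word v) • m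
            simp only [← mul_smul, ← op_mul, T.mul_word, Finset.op_sum, Finset.sum_smul]) }
      map_deg := fun i m hm v _ => M.op_smul_mem hm (T.word_mem v) }
  naturality M N g := by
    refine GrMod.Hom.ext (LinearMap.ext fun m => Subtype.ext (funext fun v => ?_))
    exact (map_smul g.toLin (op (T.word v)) m).symm

theorem toRestrictExtend_apply (M : GrMod.{t} 𝒜) (m : M.carrier) (v : W) :
    ((T.toRestrictExtend.app M).toLin m : T.family M).1 v = op (T.word v) • m := rfl

/-- Under `rep ∘ map`, the element `word y` becomes a matrix whose only nonzero row is the row `y`.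
So the sum in `mul_word` for `word y * word z` has a single term. -/
theorem word_mul_rep_map_word (v y z : W) :
    T.word v * T.rep (T.map (T.word y)) v z = if v = y then T.word v * T.word z else 0 := by
  -- Applying `rep` to `vertex v * map (word y) = 0` extracts row `v`.
  have key : ∀ v y, v ≠ y → T.rep (T.map (T.word y)) v z = 0 := by
    intro v y h
    have := congrArg (fun b => T.rep b v z) (T.vertex_mul_map_word v y)
    simpa [h, T.rep_vertex] using! this
  split_ifs with h
  · subst h
    rw [T.mul_word, Finset.sum_eq_single v]
    · exact fun y _ h => by rw [key y v h, mul_zero]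
    · simp
  · rw [key v y h, mul_zero]

/-- An element of degree at least `len` is a sum of multiples `word y * c`, so it suffices to act by
the words. They annihilate the kernel by definition of the map, and they carry every row vector into
the image. -/
theorem fdimIso_toRestrictExtend_app [∀ n, FiniteDimensional k (𝒜 n)] (M : GrMod.{t} 𝒜) :
    fdimIso 𝒜 (T.toRestrictExtend.app M) := by
  rw [GrMod.fdimIso_iff]
  refine ⟨fun m hm => ⟨T.len, fun i hi a ha => ?_⟩, fun x => ⟨T.len, fun i hi a ha => ?_⟩⟩
  · obtain ⟨c, rfl⟩ := T.exists_eq_sum hi ha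
    rw [Finset.op_sum, Finset.sum_smul]
    refine Finset.sum_eq_zero fun v _ => ?_
    have h : op (T.word v) • m = 0 := congrFun (congrArg Subtype.val hm) v
    rw [op_mul, mul_smul]
    erw [h]
    exact smul_zero _
  · obtain ⟨c, rfl⟩ := T.exists_eq_sum hi ha
    rw [Finset.op_sum, Finset.sum_smul]
    refine Submodule.sum_mem _ fun y _ => ?_
    rw [op_mul, mul_smul]
    refine Submodule.smul_mem _ _ ?_
    change T.family M at x
    induction x using T.family_induction with
    | zero =>
      have := Submodule.zero_mem (LinearMap.range (T.toRestrictExtend.app M).toLin)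
      rwa [← smul_zero (op (T.word y))] at this
    | add x x' h h' => exact Submodule.smul_add_mem _ (op (T.word y)) h h'
    | single v m =>
      -- Acting by `word y` on the vector with entry `m · word v` gives zero unless `v = y`, and
      -- then gives the image of `m · word v`.
      refine ⟨if v = y then op (T.word v) • m else 0, ?_⟩
      refine Subtype.ext (funext fun z => ?_)
      refine Eq.trans ?_ (T.op_smul_single M (T.map (T.word y)) v z m).symm
      rw [toRestrictExtend_apply, word_mul_rep_map_word]
      split_ifs with h
      · rw [← mul_smul, op_mul]
      · simp

/-- The natural homomorphism `n ↦ (n · map (word v))ᵥ`. -/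
def toExtendRestrict :
    𝟭 (GrMod.{t} ℬ) ⟶ GrMod.restrict T.map T.map_mem ⋙ T.extend where
  app N :=
    { toLin :=
        { toFun := fun n => (⟨fun v => (op (T.map (T.word v)) • n : N.carrier),
            mem_family.2 fun v => ⟨n, rfl⟩⟩ :
              T.family ((GrMod.restrict T.map T.map_mem).obj N))
          map_add' := fun x y => Subtype.ext (funext fun v =>
            smul_add (op (T.map (T.word v))) (x : N.carrier) y)
          map_smul' := fun b n => Subtype.ext (funext fun z => by
            change (op (T.map (T.word z)) • op b.unop • n : N.carrier) =
              ∑ v, (op (T.map (T.rep b.unop v z)) • op (T.map (T.word v)) • n : N.carrier)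
            simp only [← mul_smul, ← op_mul, T.mul_map_word, Finset.op_sum, Finset.sum_smul,
              map_mul]) }
      map_deg := fun i m hm v _ => N.op_smul_mem hm (T.map_mem (T.word_mem v)) }
  naturality M N g := by
    refine GrMod.Hom.ext (LinearMap.ext fun m => Subtype.ext (funext fun v => ?_))
    exact (map_smul g.toLin (op (T.map (T.word v))) m).symm

theorem toExtendRestrict_apply (N : GrMod.{t} ℬ) (n : N.carrier) (v : W) :
    ((T.toExtendRestrict.app N).toLin n :
      T.family ((GrMod.restrict T.map T.map_mem).obj N)).1 v =
        (op (T.map (T.word v)) • n : N.carrier) := rfl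

/-- Here the map is even surjective, because the idempotents of `B` separate the entries. Only the
kernel needs large degree. -/
theorem fdimIso_toExtendRestrict_app [∀ n, FiniteDimensional k (ℬ n)] (N : GrMod.{t} ℬ) :
    fdimIso ℬ (T.toExtendRestrict.app N) := by
  rw [GrMod.fdimIso_iff]
  refine ⟨fun n hn => ⟨T.len, fun i hi b hb => ?_⟩, fun x => ⟨0, fun i _ b _ => ?_⟩⟩
  · change N.carrier at n
    change op b • n = 0
    have h : ∀ v, op (T.map (T.word v)) • n = 0 := fun v => congrFun (congrArg Subtype.val hn) v
    have hb' := T.mem_span hb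
    clear hb
    induction hb' using Submodule.span_induction with
    | mem b hb =>
      obtain ⟨a, ha, c, rfl⟩ := hb
      obtain ⟨d, rfl⟩ := T.exists_eq_sum hi ha
      simp only [map_sum, map_mul, Finset.sum_mul, Finset.op_sum, Finset.sum_smul, op_mul,
        mul_smul, h, smul_zero, Finset.sum_const_zero]
    | zero => simp
    | add x y _ _ hx hy => rw [MulOpposite.op_add, add_smul, hx, hy, add_zero]
    | smul c x _ hx => rw [MulOpposite.op_smul, smul_assoc, hx, smul_zero]
  · refine Submodule.smul_mem _ _ ?_
    change T.family ((GrMod.restrict T.map T.map_mem).obj N) at x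
    induction x using T.family_induction with
    | zero => exact Submodule.zero_mem _
    | add x y hx hy => exact Submodule.add_mem _ hx hy
    | single v n =>
      change N.carrier at n
      -- Multiplying `n` by `vertex v` first removes every entry but the one at `v`.
      refine ⟨(op (T.vertex v) • n : N.carrier), Subtype.ext (funext fun z => ?_)⟩
      rw [toExtendRestrict_apply, ← mul_smul, ← op_mul, T.vertex_mul_map_word]
      by_cases h : v = z
      · subst h
        rw [if_pos rfl]
        exact (T.single_same ((GrMod.restrict T.map T.map_mem).obj N) v n).symm
      · rw [if_neg h, op_zero, zero_smul]
        exact (T.single_ne ((GrMod.restrict T.map T.map_mem).obj N) (Ne.symm h) n).symm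

theorem nonempty_qGr_equivalence [∀ n, FiniteDimensional k (𝒜 n)] [∀ n, FiniteDimensional k (ℬ n)]
    (T : TransferDatum 𝒜 ℬ W) : Nonempty (QGr.{t} 𝒜 ≌ QGr.{t} ℬ) :=
  Localization.nonempty_equivalence_of_natTrans (fdimIso 𝒜) (fdimIso ℬ) T.extend
    (GrMod.restrict T.map T.map_mem) (fun _ _ f hf => T.fdimIso_extend_map f hf)
    (fun _ _ f hf => GrMod.fdimIso_restrict_map T.map T.map_mem f hf)
    T.toRestrictExtend T.fdimIso_toRestrictExtend_app
    T.toExtendRestrict T.fdimIso_toExtendRestrict_app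

end TransferDatum

end

/-! ### Generators of path algebras and homomorphisms out of them -/

namespace PathAlgebra

variable (k : Type u) [Field k] {V : Type v} [Quiver.{w} V]

/-- The trivial path at a vertex. -/
def vertex (a : V) : PathAlgebra k V := ofPath k ⟨a, a, Quiver.Path.nil⟩

/-- The path of length one given by an arrow. -/
def arrow {a b : V} (e : a ⟶ b) : PathAlgebra k V := ofPath k ⟨a, b, e.toPath⟩

theorem vertex_mul_vertex_of_ne {a b : V} (h : a ≠ b) : vertex k a * vertex k b = 0 :=
  ofPath_mul_ofPath_of_ne k _ _ h

theorem vertex_mul_self (a : V) : vertex k a * vertex k a = vertex k a :=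
  ofPath_mul_ofPath_comp k _ _

theorem vertex_mul_arrow {a b : V} (e : a ⟶ b) : vertex k a * arrow k e = arrow k e := by
  rw [vertex, arrow, ofPath_mul_ofPath_comp, Quiver.Path.nil_comp]

theorem vertex_mul_arrow_of_ne {a b c : V} (e : a ⟶ b) (h : c ≠ a) :
    vertex k c * arrow k e = 0 :=
  ofPath_mul_ofPath_of_ne k _ _ h

theorem arrow_mul_vertex {a b : V} (e : a ⟶ b) : arrow k e * vertex k b = arrow k e :=
  ofPath_mul_ofPath_comp k _ _

theorem arrow_mul_vertex_of_ne {a b c : V} (e : a ⟶ b) (h : b ≠ c) :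
    arrow k e * vertex k c = 0 :=
  ofPath_mul_ofPath_of_ne k _ _ h

theorem arrow_mul_arrow_of_ne {a b c d : V} (e : a ⟶ b) (e' : c ⟶ d) (h : b ≠ c) :
    arrow k e * arrow k e' = 0 :=
  ofPath_mul_ofPath_of_ne k _ _ h

theorem ofPath_cons {a b c : V} (p : Quiver.Path a b) (e : b ⟶ c) :
    ofPath k ⟨a, c, p.cons e⟩ = ofPath k ⟨a, b, p⟩ * arrow k e := by
  rw [arrow, ofPath_mul_ofPath_comp]; rfl

variable [Finite V]

theorem vertex_mem (a : V) : vertex k a ∈ grading k V 0 :=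
  ofPath_mem_grading (k := k) ⟨a, a, Quiver.Path.nil⟩

theorem arrow_mem {a b : V} (e : a ⟶ b) : arrow k e ∈ grading k V 1 :=
  ofPath_mem_grading (k := k) ⟨a, b, e.toPath⟩

theorem sum_vertex [Fintype V] : ∑ a : V, vertex k a = 1 := by
  rw [one_def, finsum_eq_sum_of_fintype]; rfl

variable {k} in
@[elab_as_elim]
theorem generator_induction {motive : PathAlgebra k V → Prop} (x : PathAlgebra k V)
    (zero : motive 0) (add : ∀ x y, motive x → motive y → motive (x + y))
    (smul : ∀ (c : k) x, motive x → motive (c • x))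
    (mul : ∀ x y, motive x → motive y → motive (x * y)) (vertex : ∀ a, motive (vertex k a))
    (arrow : ∀ {a b : V} (e : a ⟶ b), motive (arrow k e)) : motive x := by
  induction x using induction_on with
  | zero => exact zero
  | add x y hx hy => exact add x y hx hy
  | smul_ofPath c p =>
    obtain ⟨a, b, p⟩ := p
    refine smul c _ ?_
    induction p with
    | nil => exact vertex _
    | cons p e h => rw [ofPath_cons]; exact mul _ _ h (arrow e)

section Lift

variable {E : Type v'} [Ring E] (ε : V → E) (x : ∀ a b : V, (a ⟶ b) → E)

/-- The image of a path under the homomorphism with prescribed values on vertices and arrows. -/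
def liftPath : ∀ {a b : V}, Quiver.Path a b → E
  | a, _, Quiver.Path.nil => ε a
  | _, _, Quiver.Path.cons p e => liftPath p * x _ _ e

theorem liftPath_nil (a : V) : liftPath ε x (Quiver.Path.nil : Quiver.Path a a) = ε a := by
  rw [liftPath]

theorem liftPath_cons {a b c : V} (p : Quiver.Path a b) (e : b ⟶ c) :
    liftPath ε x (p.cons e) = liftPath ε x p * x b c e := by
  rw [liftPath]

variable [Algebra k E] [Fintype V] (hε : ∀ a, ε a * ε a = ε a) (hε' : ∀ a b, a ≠ b → ε a * ε b = 0)
  (hsum : ∑ a, ε a = 1) (hl : ∀ (a b : V) (e : a ⟶ b), ε a * x a b e = x a b e)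
  (hr : ∀ (a b : V) (e : a ⟶ b), x a b e * ε b = x a b e)

include hε hr in
theorem liftPath_mul_end {a b : V} (p : Quiver.Path a b) :
    liftPath ε x p * ε b = liftPath ε x p := by
  cases p with
  | nil => rw [liftPath_nil, hε]
  | cons p e => rw [liftPath_cons, mul_assoc, hr]

include hε in
theorem start_mul_liftPath {a b : V} (p : Quiver.Path a b) :
    ε a * liftPath ε x p = liftPath ε x p := by
  induction p with
  | nil => rw [liftPath_nil, hε]
  | cons p e h => rw [liftPath_cons, ← mul_assoc, h]

include hε hr in
theorem liftPath_comp {a b c : V} (p : Quiver.Path a b) (q : Quiver.Path b c) :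
    liftPath ε x (p.comp q) = liftPath ε x p * liftPath ε x q := by
  induction q with
  | nil => rw [liftPath_nil, liftPath_mul_end ε x hε hr, Quiver.Path.comp_nil]
  | cons q e h => rw [Quiver.Path.comp_cons, liftPath_cons, h, liftPath_cons, mul_assoc]

/-- The homomorphism of algebras with prescribed values on vertices and arrows. -/
def lift : PathAlgebra k V →ₐ[k] E :=
  AlgHom.ofLinearMap ((pathBasis k).constr k fun p => liftPath ε x p.2.2)
    (by
      have h (a : V) : (pathBasis k).constr k (fun p : QuiverPath V => liftPath ε x p.2.2)
          (vertex k a) = ε a :=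
        ((pathBasis k).constr_basis k _ _).trans (liftPath_nil ε x a)
      rw [← sum_vertex, map_sum, ← hsum]
      exact Finset.sum_congr rfl fun a _ => h a)
    (by
      have h (p : QuiverPath V) : (pathBasis k).constr k
          (fun p : QuiverPath V => liftPath ε x p.2.2) (ofPath k p) = liftPath ε x p.2.2 :=
        (pathBasis k).constr_basis k _ _
      intro y z
      induction y using induction_on with
      | zero => simp
      | add y y' hy hy' => rw [add_mul, map_add, hy, hy', map_add, add_mul]
      | smul_ofPath c p =>
        induction z using induction_on with
        | zero => simp
        | add z z' hz hz' => rw [mul_add, map_add, hz, hz', map_add, mul_add]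
        | smul_ofPath d q =>
          obtain ⟨a, b, p⟩ := p
          obtain ⟨a', b', q⟩ := q
          simp only [smul_mul_assoc, mul_smul_comm, map_smul, h]
          by_cases hb : b = a'
          · subst hb
            rw [ofPath_mul_ofPath_comp, h, liftPath_comp ε x hε hr]
          · rw [ofPath_mul_ofPath_of_ne k _ _ hb, map_zero, ← liftPath_mul_end ε x hε hr p,
              ← start_mul_liftPath ε x hε q, mul_assoc, ← mul_assoc (ε b), hε' b a' hb, zero_mul,
              mul_zero])

theorem lift_ofPath (p : QuiverPath V) :
    lift k ε x hε hε' hsum hr (ofPath k p) = liftPath ε x p.2.2 :=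
  (pathBasis k).constr_basis k _ _

theorem lift_vertex (a : V) : lift k ε x hε hε' hsum hr (vertex k a) = ε a :=
  (lift_ofPath k ε x hε hε' hsum hr _).trans (liftPath_nil ε x a)

include hl in
theorem lift_arrow {a b : V} (e : a ⟶ b) : lift k ε x hε hε' hsum hr (arrow k e) = x a b e :=
  (lift_ofPath k ε x hε hε' hsum hr _).trans
    ((liftPath_cons ε x _ e).trans (by rw [liftPath_nil, hl]))

end Lift

variable {k} in
/-- A homomorphism maps the part of degree `n` to the `n`-th term of a family of subspaces if it
does so for vertices and the family is stable under the images of the arrows. -/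
theorem map_mem_of_mem_grading {E : Type v'} [Ring E] [Algebra k E] (f : PathAlgebra k V →ₐ[k] E)
    (P : ℕ → Submodule k E) (hv : ∀ a, f (vertex k a) ∈ P 0)
    (he : ∀ n, ∀ y ∈ P n, ∀ {a b : V} (e : a ⟶ b), y * f (arrow k e) ∈ P (n + 1))
    {n : ℕ} {y : PathAlgebra k V} (hy : y ∈ grading k V n) : f y ∈ P n := by
  have h : grading k V n ≤ (P n).comap f.toLinearMap := by
    rw [grading, Submodule.span_le]
    rintro _ ⟨⟨a, b, p⟩, rfl, rfl⟩
    change f (ofPath k ⟨a, b, p⟩) ∈ P p.length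
    clear hy
    induction p with
    | nil => exact hv _
    | cons p e h => rw [ofPath_cons, map_mul]; exact he _ _ h e
  exact h hy

theorem finite_quiverPath_length [∀ a b : V, Finite (a ⟶ b)] (n : ℕ) :
    {p : QuiverPath V | p.2.2.length = n}.Finite := by
  induction n with
  | zero =>
    refine (Set.finite_range fun a : V => (⟨a, a, Quiver.Path.nil⟩ : QuiverPath V)).subset ?_
    rintro ⟨a, b, p⟩ hp
    cases p with
    | nil => exact ⟨a, rfl⟩
    | cons p e => exact absurd hp (Nat.succ_ne_zero _)
  | succ n ih =>
    have := ih.to_subtype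
    refine (Set.finite_range fun q : Σ (p : {p : QuiverPath V | p.2.2.length = n}) (b : V),
      (p.1.2.1 ⟶ b) => (⟨q.1.1.1, q.2.1, q.1.1.2.2.cons q.2.2⟩ : QuiverPath V)).subset ?_
    rintro ⟨a, b, p⟩ hp
    cases p with
    | nil => exact absurd hp (Nat.succ_ne_zero _).symm
    | cons p e => exact ⟨⟨⟨⟨_, _, p⟩, Nat.succ_injective hp⟩, _, e⟩, rfl⟩

instance [∀ a b : V, Finite (a ⟶ b)] (n : ℕ) : FiniteDimensional k (grading k V n) :=
  FiniteDimensional.span_of_finite k ((finite_quiverPath_length n).image _)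

end PathAlgebra

instance MonomialAlgebra.finiteDimensional_grading (k : Type u) [Field k] {V : Type v}
    [Quiver.{w} V] [Finite V] (F : Set (QuiverPath V)) [∀ a b : V, Finite (a ⟶ b)] (n : ℕ) :
    FiniteDimensional k (grading k F n) :=
  inferInstanceAs (FiniteDimensional k
    ((PathAlgebra.grading k V n).map (MonomialAlgebra.mk k F).toLinearMap))

/-! ### The Ufnarovskii graph of words and its matrix representation -/

section UfnarovskiiGraph

open PathAlgebra

variable {I : Type w} {A : Type v}

/-- The product in `A` of the letters of a word. -/
def wordProd [Monoid A] (x : I → A) (u : List I) : A := (u.map x).prod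

theorem wordProd_nil [Monoid A] (x : I → A) : wordProd x [] = 1 := rfl

theorem wordProd_cons [Monoid A] (x : I → A) (a : I) (u : List I) :
    wordProd x (a :: u) = x a * wordProd x u := List.prod_cons

theorem wordProd_append [Monoid A] (x : I → A) (u v : List I) :
    wordProd x (u ++ v) = wordProd x u * wordProd x v := by
  rw [wordProd, List.map_append, List.prod_append]; rfl

theorem wordProd_concat [Monoid A] (x : I → A) (u : List I) (a : I) :
    wordProd x (u ++ [a]) = wordProd x u * x a := by
  rw [wordProd_append, wordProd_cons, wordProd_nil, mul_one]

/-- The vertices of the Ufnarovskii graph: the words of length `l + 1` with nonzero product. -/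
def UfnarovskiiGraph [MonoidWithZero A] (x : I → A) (l : ℕ) : Type w :=
  {u : List I // u.length = l + 1 ∧ wordProd x u ≠ 0}

namespace UfnarovskiiGraph

section Basic

variable [MonoidWithZero A] {x : I → A} {l : ℕ}

/-- There is an arrow `v ⟶ z` for each word with nonzero product that is of the form `a z = v b`
with letters `a` and `b`. -/
instance : Quiver.{w} (UfnarovskiiGraph x l) where
  Hom v z := {p : I × I // p.1 :: z.1 = v.1 ++ [p.2] ∧ wordProd x (p.1 :: z.1) ≠ 0}

instance [Finite I] : Finite (UfnarovskiiGraph x l) :=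
  ((List.finite_length_eq I (l + 1)).subset fun _ h => h.1).to_subtype

instance [Finite I] (v z : UfnarovskiiGraph x l) : Finite (v ⟶ z) :=
  inferInstanceAs (Finite {_p : I × I // _})

instance [Finite I] : Fintype (UfnarovskiiGraph x l) := Fintype.ofFinite _

instance : DecidableEq (UfnarovskiiGraph x l) := Classical.decEq _

/-- The product of the word that is a vertex. -/
def word (v : UfnarovskiiGraph x l) : A := wordProd x v.1

theorem ne_nil (v : UfnarovskiiGraph x l) : v.1 ≠ [] :=
  List.ne_nil_of_length_pos (by rw [v.2.1]; omega)

/-- The first letter of a vertex. -/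
def first (v : UfnarovskiiGraph x l) : I := v.1.head v.ne_nil

theorem cons_tail (v : UfnarovskiiGraph x l) : v.first :: v.1.tail = v.1 :=
  List.cons_head_tail v.ne_nil

/-- The first letter of the word that is an arrow. -/
def label {v z : UfnarovskiiGraph x l} (e : v ⟶ z) : I := e.1.1

/-- The last letter of the word that is an arrow. -/
def lastLetter {v z : UfnarovskiiGraph x l} (e : v ⟶ z) : I := e.1.2

theorem label_cons {v z : UfnarovskiiGraph x l} (e : v ⟶ z) :
    label e :: z.1 = v.1 ++ [lastLetter e] := e.2.1

theorem wordProd_label_cons_ne_zero {v z : UfnarovskiiGraph x l} (e : v ⟶ z) :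
    wordProd x (label e :: z.1) ≠ 0 := e.2.2

theorem first_eq_label {v z : UfnarovskiiGraph x l} (e : v ⟶ z) : v.first = label e := by
  have h := label_cons e
  rw [← v.cons_tail, List.cons_append, List.cons.injEq] at h
  exact h.1.symm

/-- The two factorizations `v b = a z` of the word of an arrow, read in `A`. Every compatibility
between labels and last letters comes from this equation. -/
theorem word_mul_lastLetter {v z : UfnarovskiiGraph x l} (e : v ⟶ z) :
    v.word * x (lastLetter e) = x (label e) * z.word := by
  rw [word, ← wordProd_concat, ← label_cons, wordProd_cons, word]

/-- Since `a z = v b`, a prefix of `a z` that is no longer than `v` is a prefix of `v`. -/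
theorem label_cons_prefix_of_prefix {v z : UfnarovskiiGraph x l} (e : v ⟶ z) {u : List I}
    (hu : u <+: z.1) (hl : u.length ≤ l) : label e :: u <+: v.1 := by
  have h : label e :: u <+: v.1 ++ [lastLetter e] := by
    rw [← label_cons]
    exact List.cons_prefix_cons.2 ⟨rfl, hu⟩
  refine List.prefix_of_prefix_length_le h (List.prefix_append _ _) ?_
  rw [v.2.1, List.length_cons]
  omega

/-- The beginning of the word `a z`. -/
def pred (a : I) (z : UfnarovskiiGraph x l) (h : wordProd x (a :: z.1) ≠ 0) :
    UfnarovskiiGraph x l :=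
  ⟨(a :: z.1).dropLast, by simp [z.2.1], fun h0 => h (by
    rw [← List.dropLast_append_getLast (List.cons_ne_nil a z.1), wordProd_append, h0, zero_mul])⟩

/-- The arrow with label `a` that ends at `z`. -/
def predHom (a : I) (z : UfnarovskiiGraph x l) (h : wordProd x (a :: z.1) ≠ 0) :
    pred a z h ⟶ z :=
  ⟨(a, (a :: z.1).getLast (List.cons_ne_nil a z.1)),
    (List.dropLast_append_getLast (List.cons_ne_nil a z.1)).symm, h⟩

end Basic

variable (k : Type u) [Field k]

section InArrow

variable [MonoidWithZero A] {x : I → A} {l : ℕ}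

open Classical in
/-- The arrow with label `a` that ends at `z`, if there is one, and `0` otherwise. -/
def inArrow (a : I) (z : UfnarovskiiGraph x l) : PathAlgebra k (UfnarovskiiGraph x l) :=
  if h : wordProd x (a :: z.1) ≠ 0 then arrow k (predHom a z h) else 0

/-- An arrow is determined by its label `a` and its target `z`: the word `a z` determines both its
beginning `v` and its last letter. -/
theorem inArrow_label {v z : UfnarovskiiGraph x l} (e : v ⟶ z) :
    inArrow k (label e) z = arrow k e := by
  have key : ∀ {v v' : UfnarovskiiGraph x l} (e : v ⟶ z) (e' : v' ⟶ z), label e = label e' →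
      arrow k e = arrow k e' := by
    intro v v' e e' h
    have h₁ := label_cons e
    rw [h, label_cons e'] at h₁
    obtain ⟨h₂, h₃⟩ := List.append_inj' h₁ rfl
    obtain rfl : v = v' := Subtype.ext h₂.symm
    obtain rfl : e = e' := Subtype.ext (Prod.ext h (List.singleton_inj.1 h₃).symm)
    rfl
  rw [inArrow, dif_pos (wordProd_label_cons_ne_zero e)]
  exact key _ _ rfl

theorem inArrow_cases (a : I) (z : UfnarovskiiGraph x l) :
    (inArrow k a z = 0 ∧ wordProd x (a :: z.1) = 0) ∨
      ∃ (v : UfnarovskiiGraph x l) (e : v ⟶ z), label e = a ∧ inArrow k a z = arrow k e := by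
  by_cases h : wordProd x (a :: z.1) = 0
  · exact Or.inl ⟨dif_neg (not_not.2 h), h⟩
  · exact Or.inr ⟨pred a z h, predHom a z h, rfl, dif_pos h⟩

variable [Finite I]

variable (x l) in
/-- The sum of all arrows with label `a`. -/
def labelSum (a : I) : PathAlgebra k (UfnarovskiiGraph x l) := ∑ z, inArrow k a z

theorem inArrow_mul_vertex (a : I) (z y : UfnarovskiiGraph x l) :
    inArrow k a z * vertex k y = if z = y then inArrow k a z else 0 := by
  obtain ⟨h, -⟩ | ⟨v, e, -, h⟩ := inArrow_cases k a z
  · rw [h, zero_mul, ite_self]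
  · rw [h]
    split_ifs with hz
    · subst hz; exact arrow_mul_vertex k e
    · exact arrow_mul_vertex_of_ne k e hz

theorem labelSum_mul_vertex (a : I) (z : UfnarovskiiGraph x l) :
    labelSum k x l a * vertex k z = inArrow k a z := by
  rw [labelSum, Finset.sum_mul]
  simp only [inArrow_mul_vertex, Finset.sum_ite_eq', Finset.mem_univ, if_true]

theorem inArrow_mem (a : I) (z : UfnarovskiiGraph x l) :
    inArrow k a z ∈ grading k (UfnarovskiiGraph x l) 1 := by
  obtain ⟨h, -⟩ | ⟨v, e, -, h⟩ := inArrow_cases k a z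
  · rw [h]; exact Submodule.zero_mem _
  · rw [h]; exact arrow_mem k e

theorem labelSum_mem (a : I) : labelSum k x l a ∈ grading k (UfnarovskiiGraph x l) 1 :=
  Submodule.sum_mem _ fun z _ => inArrow_mem k a z

/-- The product is the sum of the paths that leave `v` with labels `u`. Each step of such a path
shifts the window by one letter, so up to length `l + 1` its labels must spell a prefix of `v`. -/
theorem vertex_mul_wordProd_labelSum (u : List I) (v : UfnarovskiiGraph x l)
    (hu : u.length ≤ l + 1) (huv : ¬ u <+: v.1) :
    vertex k v * wordProd (labelSum k x l) u = 0 := by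
  induction u generalizing v with
  | nil => exact absurd List.nil_prefix huv
  | cons a u ih =>
    rw [wordProd_cons, labelSum, ← mul_assoc, Finset.mul_sum, Finset.sum_mul]
    refine Finset.sum_eq_zero fun z _ => ?_
    obtain ⟨h, -⟩ | ⟨y, e, rfl, h⟩ := inArrow_cases k a z
    · rw [h, mul_zero, zero_mul]
    · rw [h]
      by_cases hy : v = y
      · subst hy
        -- Inserting the vertex at the end of `e` lets the induction hypothesis apply to the
        -- remaining letters.
        rw [vertex_mul_arrow, ← arrow_mul_vertex, mul_assoc, ih, mul_zero]
        · simp only [List.length_cons] at hu; omega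
        · exact fun hz => huv (label_cons_prefix_of_prefix e hz (by simpa using hu))
      · rw [vertex_mul_arrow_of_ne k e hy, zero_mul]

theorem vertex_mul_wordProd_vertex (v z : UfnarovskiiGraph x l) :
    vertex k v * wordProd (labelSum k x l) z.1 =
      if v = z then wordProd (labelSum k x l) v.1 else 0 := by
  have h : ∀ v z : UfnarovskiiGraph x l, v ≠ z →
      vertex k v * wordProd (labelSum k x l) z.1 = 0 := fun v z hvz =>
    vertex_mul_wordProd_labelSum k z.1 v z.2.1.le fun hp =>
      hvz (Subtype.ext (hp.eq_of_length (by rw [v.2.1, z.2.1])).symm)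
  split_ifs with hvz
  · subst hvz
    -- Writing `1` as the sum of all vertices, only `v` can precede the full word of `v`.
    conv_rhs => rw [← one_mul (wordProd _ _), ← sum_vertex, Finset.sum_mul]
    rw [Finset.sum_eq_single v]
    · exact fun y _ hy => h y v hy
    · simp
  · exact h v z hvz

end InArrow

section Rep

variable [Finite I] [Ring A] [Algebra k A] (x : I → A) (l : ℕ)

/-- The matrix representation of the path algebra of the Ufnarovskii graph that sends a path to the
matrix unit given by its ends, times the product of the last letters of its arrows. -/
def rep : PathAlgebra k (UfnarovskiiGraph x l) →ₐ[k]
    Matrix (UfnarovskiiGraph x l) (UfnarovskiiGraph x l) A :=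
  lift k (fun v => Matrix.single v v 1) (fun v z e => Matrix.single v z (x (lastLetter e)))
    (fun v => by rw [Matrix.single_mul_single_same, mul_one])
    (fun v z h => Matrix.single_mul_single_of_ne _ _ _ _ h _)
    (Matrix.sum_single_one)
    (fun v z e => by rw [Matrix.single_mul_single_same, mul_one])

theorem rep_vertex (v : UfnarovskiiGraph x l) : rep k x l (vertex k v) = Matrix.single v v 1 :=
  lift_vertex ..

theorem rep_arrow {v z : UfnarovskiiGraph x l} (e : v ⟶ z) :
    rep k x l (arrow k e) = Matrix.single v z (x (lastLetter e)) :=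
  lift_arrow _ _ _ _ _ _ (fun v z e => by rw [Matrix.single_mul_single_same, one_mul]) _ _

theorem sum_word_mul_rep_arrow {v z : UfnarovskiiGraph x l} (e : v ⟶ z)
    (y : UfnarovskiiGraph x l) : ∑ v', v'.word * rep k x l (arrow k e) v' y =
      if z = y then x (label e) * y.word else 0 := by
  rw [rep_arrow, Finset.sum_eq_single v]
  · split_ifs with h
    · subst h
      rw [Matrix.single_apply_same, word_mul_lastLetter]
    · rw [Matrix.single_apply_of_col_ne _ _ h, mul_zero]
  · exact fun v' _ h => by rw [Matrix.single_apply_of_row_ne h.symm, mul_zero]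
  · simp

/-- Only the arrow with label `a` ending at `z = y` contributes to column `y`, and it gives `v b = a
y`. If there is no such arrow, then `a y = 0` in `A`. -/
theorem sum_word_mul_rep_labelSum (a : I) (y : UfnarovskiiGraph x l) :
    ∑ v, v.word * rep k x l (labelSum k x l a) v y = x a * y.word := by
  have h : ∀ z : UfnarovskiiGraph x l, ∑ v, v.word * rep k x l (inArrow k a z) v y =
      if z = y then x a * y.word else 0 := by
    intro z
    obtain ⟨h, h'⟩ | ⟨v, e, rfl, h⟩ := inArrow_cases k a z
    · rw [h]
      split_ifs with hz
      · subst hz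
        rw [word, ← wordProd_cons, h']
        simp
      · simp
    · rw [h, sum_word_mul_rep_arrow]
  rw [labelSum, map_sum]
  simp only [Matrix.sum_apply, Finset.mul_sum]
  rw [Finset.sum_comm]
  simp only [h, Finset.sum_ite_eq', Finset.mem_univ, if_true]

variable {x} {𝒜 : ℕ → Submodule k A} [GradedAlgebra 𝒜] (hx : ∀ a, x a ∈ 𝒜 1)

include hx in
theorem rep_mem {i : ℕ} {b : PathAlgebra k (UfnarovskiiGraph x l)}
    (hb : b ∈ grading k (UfnarovskiiGraph x l) i) (v z : UfnarovskiiGraph x l) :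
    rep k x l b v z ∈ 𝒜 i := by
  let P (n : ℕ) : Submodule k (Matrix (UfnarovskiiGraph x l) (UfnarovskiiGraph x l) A) :=
    { carrier := {M | ∀ v z, M v z ∈ 𝒜 n}
      add_mem' := fun hM hN v z => Submodule.add_mem _ (hM v z) (hN v z)
      zero_mem' := fun v z => Submodule.zero_mem _
      smul_mem' := fun c M hM v z => Submodule.smul_mem _ c (hM v z) }
  refine map_mem_of_mem_grading (rep k x l) P (fun y v z => ?_) (fun n M hM y y' e v z => ?_) hb v z
  · rw [rep_vertex, Matrix.single_apply]
    split_ifs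
    · exact SetLike.GradedOne.one_mem
    · exact Submodule.zero_mem _
  · rw [Matrix.mul_apply]
    refine Submodule.sum_mem _ fun j _ => SetLike.GradedMul.mul_mem (hM v j) ?_
    rw [rep_arrow, Matrix.single_apply]
    split_ifs
    · exact hx _
    · exact Submodule.zero_mem _

-- Iterating `v b = a z` along a path from `v` to `z` trades its last letters, on the right of `v`,
-- for its labels, on the left of `z`. There are equally many of each, so the degree is kept.
include hx in
theorem word_mul_rep {i : ℕ} {b : PathAlgebra k (UfnarovskiiGraph x l)}
    (hb : b ∈ grading k (UfnarovskiiGraph x l) i) (v z : UfnarovskiiGraph x l) :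
    ∃ a ∈ 𝒜 i, v.word * rep k x l b v z = a * z.word := by
  let P (n : ℕ) : Submodule k (Matrix (UfnarovskiiGraph x l) (UfnarovskiiGraph x l) A) :=
    { carrier := {M | ∀ v z, ∃ a ∈ 𝒜 n, v.word * M v z = a * z.word}
      add_mem' := fun {M N} hM hN v z => by
        obtain ⟨a, ha, h⟩ := hM v z
        obtain ⟨a', ha', h'⟩ := hN v z
        exact ⟨a + a', Submodule.add_mem _ ha ha', by rw [Matrix.add_apply, mul_add, h, h', add_mul]⟩
      zero_mem' := fun v z => ⟨0, Submodule.zero_mem _, by simp⟩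
      smul_mem' := fun c M hM v z => by
        obtain ⟨a, ha, h⟩ := hM v z
        exact ⟨c • a, Submodule.smul_mem _ c ha, by
          rw [Matrix.smul_apply, mul_smul_comm, h, smul_mul_assoc]⟩ }
  refine map_mem_of_mem_grading (rep k x l) P (fun y v z => ?_) (fun n M hM y y' e v z => ?_) hb v z
  · rw [rep_vertex, Matrix.single_apply]
    split_ifs with h
    · obtain ⟨rfl, rfl⟩ := h
      exact ⟨1, SetLike.GradedOne.one_mem, by rw [mul_one, one_mul]⟩
    · exact ⟨0, Submodule.zero_mem _, by rw [mul_zero, zero_mul]⟩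
  · obtain ⟨a, ha, h⟩ := hM v y
    rw [Matrix.mul_apply, rep_arrow, Finset.sum_eq_single y]
    · by_cases hz : y' = z
      · subst hz
        refine ⟨a * x (label e), SetLike.GradedMul.mul_mem ha (hx _), ?_⟩
        rw [Matrix.single_apply_same, ← mul_assoc, h, mul_assoc, word_mul_lastLetter, mul_assoc]
      · exact ⟨0, Submodule.zero_mem _, by
          rw [Matrix.single_apply_of_col_ne _ _ hz, mul_zero, mul_zero, zero_mul]⟩
    · exact fun j _ hj => by rw [Matrix.single_apply_of_row_ne hj.symm, mul_zero]
    · simp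

include hx in
theorem word_mem (v : UfnarovskiiGraph x l) : v.word ∈ 𝒜 (l + 1) := by
  have h : ∀ u : List I, wordProd x u ∈ 𝒜 u.length := by
    intro u
    induction u with
    | nil => exact SetLike.GradedOne.one_mem
    | cons a u ih =>
      rw [wordProd_cons, List.length_cons, add_comm]
      exact SetLike.GradedMul.mul_mem (hx a) ih
  have := h v.1
  rwa [v.2.1] at this

end Rep

end UfnarovskiiGraph

end UfnarovskiiGraph

/-! ### Monomial algebras and their Ufnarovskii graphs -/

namespace MonomialAlgebra

open PathAlgebra UfnarovskiiGraph

variable (k : Type u) [Field k] {V : Type v} [Quiver.{w} V] [Fintype V] [DecidableEq V]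
  (F : Set (QuiverPath V)) {I : Type} [Finite I] (idx : (Σ a b : V, a ⟶ b) ≃ I)

/-- The element of the monomial algebra given by an arrow. -/
def letter (i : I) : MonomialAlgebra k F := mk k F (arrow k (idx.symm i).2.2)

theorem letter_apply {a b : V} (e : a ⟶ b) :
    letter k F idx (idx ⟨a, b, e⟩) = mk k F (arrow k e) := by
  rw [letter, Equiv.symm_apply_apply]

theorem letter_mem (i : I) : letter k F idx i ∈ grading k F 1 := ⟨_, arrow_mem k _, rfl⟩

theorem mk_vertex_mul_letter (a : V) (i : I) : mk k F (vertex k a) * letter k F idx i =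
    if (idx.symm i).1 = a then letter k F idx i else 0 := by
  rw [letter, ← map_mul]
  split_ifs with h
  · subst h; rw [vertex_mul_arrow]
  · rw [vertex_mul_arrow_of_ne k _ (Ne.symm h), map_zero]

theorem letter_mul_letter_of_ne {i j : I} (h : (idx.symm i).2.1 ≠ (idx.symm j).1) :
    letter k F idx i * letter k F idx j = 0 := by
  rw [letter, letter, ← map_mul, arrow_mul_arrow_of_ne k _ _ h, map_zero]

variable {k F} in
@[elab_as_elim]
theorem generator_induction {motive : MonomialAlgebra k F → Prop} (x : MonomialAlgebra k F)
    (zero : motive 0) (add : ∀ x y, motive x → motive y → motive (x + y))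
    (smul : ∀ (c : k) x, motive x → motive (c • x))
    (mul : ∀ x y, motive x → motive y → motive (x * y)) (vertex : ∀ a, motive (mk k F (vertex k a)))
    (letter : ∀ i, motive (letter k F idx i)) : motive x := by
  obtain ⟨x, rfl⟩ := RingCon.mkₐ_surjective (α := k) _ x
  change motive (mk k F x)
  induction x using PathAlgebra.generator_induction with
  | zero => rw [map_zero]; exact zero
  | add x y hx hy => rw [map_add]; exact add _ _ hx hy
  | smul c x hx => rw [map_smul]; exact smul _ _ hx
  | mul x y hx hy => rw [map_mul]; exact mul _ _ hx hy
  | vertex a => exact vertex a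
  | arrow e => rw [← letter_apply k F idx]; exact letter _

/-- The word of a path. -/
def pathWord : ∀ {a b : V}, Quiver.Path a b → List I
  | _, _, Quiver.Path.nil => []
  | _, _, Quiver.Path.cons p e => pathWord p ++ [idx ⟨_, _, e⟩]

theorem length_pathWord {a b : V} (p : Quiver.Path a b) : (pathWord idx p).length = p.length := by
  induction p with
  | nil => rw [pathWord]; rfl
  | cons p e h => rw [pathWord, List.length_append, h]; rfl

theorem mk_ofPath {a b : V} (p : Quiver.Path a b) : mk k F (ofPath k ⟨a, b, p⟩) =
    mk k F (vertex k a) * wordProd (letter k F idx) (pathWord idx p) := by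
  induction p with
  | nil => rw [pathWord, wordProd_nil, mul_one]; rfl
  | cons p e h => rw [ofPath_cons, map_mul, h, pathWord, wordProd_concat, mul_assoc, letter_apply]

variable (l : ℕ)

/-- The Ufnarovskii graph of the monomial algebra. -/
abbrev Graph : Type := UfnarovskiiGraph (letter k F idx) l

/-- The sum of the vertices whose words start at `a`. -/
def startSum (a : V) : PathAlgebra k (Graph k F idx l) :=
  ∑ v : Graph k F idx l, if (idx.symm v.first).1 = a then vertex k v else 0

theorem mk_vertex_mul_word (a : V) (v : Graph k F idx l) :
    mk k F (vertex k a) * v.word = if (idx.symm v.first).1 = a then v.word else 0 := by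
  rw [UfnarovskiiGraph.word, ← v.cons_tail, wordProd_cons, ← mul_assoc, mk_vertex_mul_letter]
  simp only [ite_mul, zero_mul]

theorem startSum_mem (a : V) : startSum k F idx l a ∈ PathAlgebra.grading k _ 0 := by
  refine Submodule.sum_mem _ fun v _ => ?_
  split_ifs
  · exact vertex_mem k v
  · exact Submodule.zero_mem _

theorem vertex_mul_startSum (a : V) (v : Graph k F idx l) :
    vertex k v * startSum k F idx l a = if (idx.symm v.first).1 = a then vertex k v else 0 := by
  rw [startSum, Finset.mul_sum, Finset.sum_eq_single v]
  · rw [mul_ite, vertex_mul_self, mul_zero]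
  · intro z _ h
    rw [mul_ite, vertex_mul_vertex_of_ne k h.symm, mul_zero, ite_self]
  · simp

theorem startSum_mul_startSum (a b : V) :
    startSum k F idx l a * startSum k F idx l b = if a = b then startSum k F idx l a else 0 := by
  conv_lhs => rw [startSum]
  simp only [Finset.sum_mul, ite_mul, zero_mul, vertex_mul_startSum]
  split_ifs with h
  · subst h
    refine Finset.sum_congr rfl fun v _ => ?_
    split_ifs <;> rfl
  · refine Finset.sum_eq_zero fun v _ => ?_
    split_ifs with h₁ h₂
    · exact absurd (h₁.symm.trans h₂) h
    · rfl
    · rfl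

theorem sum_startSum : ∑ a, startSum k F idx l a = 1 := by
  classical
  simp only [startSum]
  rw [Finset.sum_comm, ← sum_vertex]
  refine Finset.sum_congr rfl fun v _ => ?_
  simp

theorem startSum_mul_labelSum {a b : V} (e : a ⟶ b) :
    startSum k F idx l a * labelSum k (letter k F idx) l (idx ⟨a, b, e⟩) =
      labelSum k (letter k F idx) l (idx ⟨a, b, e⟩) := by
  rw [labelSum, Finset.mul_sum]
  refine Finset.sum_congr rfl fun z _ => ?_
  obtain ⟨h, -⟩ | ⟨v, e', he, h⟩ := inArrow_cases k (idx ⟨a, b, e⟩) z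
  · rw [h, mul_zero]
  · rw [h, startSum, Finset.sum_mul, Finset.sum_eq_single v]
    · rw [if_pos, vertex_mul_arrow]
      rw [first_eq_label e', he, Equiv.symm_apply_apply]
    · intro y _ hy
      rw [ite_mul, vertex_mul_arrow_of_ne k _ hy, zero_mul, ite_self]
    · simp

theorem labelSum_mul_startSum {a b : V} (e : a ⟶ b) :
    labelSum k (letter k F idx) l (idx ⟨a, b, e⟩) * startSum k F idx l b =
      labelSum k (letter k F idx) l (idx ⟨a, b, e⟩) := by
  rw [labelSum, Finset.sum_mul]
  refine Finset.sum_congr rfl fun z _ => ?_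
  obtain ⟨h, -⟩ | ⟨v, e', he, h⟩ := inArrow_cases k (idx ⟨a, b, e⟩) z
  · rw [h, zero_mul]
  · rw [h, ← arrow_mul_vertex, mul_assoc, vertex_mul_startSum, if_pos]
    -- If the letter `a` did not end where the word `z` starts, the word `a z` would be zero, so it
    -- would not be an arrow.
    by_contra hne
    refine wordProd_label_cons_ne_zero e' ?_
    rw [← z.cons_tail, wordProd_cons, wordProd_cons, ← mul_assoc, he, letter_mul_letter_of_ne,
      zero_mul]
    rw [Equiv.symm_apply_apply]
    exact Ne.symm hne

/-- The homomorphism that sends an arrow to the sum of the arrows it labels. -/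
def preMap : PathAlgebra k V →ₐ[k] PathAlgebra k (Graph k F idx l) :=
  lift k (startSum k F idx l) (fun a b e => labelSum k (letter k F idx) l (idx ⟨a, b, e⟩))
    (fun a => by rw [startSum_mul_startSum, if_pos rfl])
    (fun a b h => by rw [startSum_mul_startSum, if_neg h])
    (sum_startSum k F idx l) (fun a b e => labelSum_mul_startSum k F idx l e)

theorem preMap_vertex (a : V) : preMap k F idx l (vertex k a) = startSum k F idx l a :=
  lift_vertex ..

theorem preMap_arrow {a b : V} (e : a ⟶ b) :
    preMap k F idx l (arrow k e) = labelSum k (letter k F idx) l (idx ⟨a, b, e⟩) :=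
  lift_arrow _ _ _ _ _ _ (fun _ _ e => startSum_mul_labelSum k F idx l e) _ _

theorem preMap_ofPath {a b : V} (p : Quiver.Path a b) : preMap k F idx l (ofPath k ⟨a, b, p⟩) =
    startSum k F idx l a * wordProd (labelSum k (letter k F idx) l) (pathWord idx p) := by
  induction p with
  | nil => rw [pathWord, wordProd_nil, mul_one]; exact preMap_vertex k F idx l a
  | cons p e h =>
    rw [ofPath_cons, map_mul, h, pathWord, wordProd_concat, mul_assoc, preMap_arrow]

theorem mk_ofPath_of_mem {p : QuiverPath V} (hp : p ∈ F) : mk k F (ofPath k p) = 0 :=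
  Quotient.sound' ((TwoSidedIdeal.mem_iff _ _).1 (TwoSidedIdeal.subset_span ⟨p, hp, rfl⟩))

/-- This is where the bound on the relations enters: a relation short enough to be compared with a
vertex could survive only as a prefix of that vertex, which would then be zero in `A`. -/
theorem preMap_ofPath_of_mem {p : QuiverPath V} (hp : p ∈ F) (hl : p.2.2.length ≤ l + 1) :
    preMap k F idx l (ofPath k p) = 0 := by
  have h0 := mk_ofPath_of_mem k F hp
  obtain ⟨a, b, p⟩ := p
  rw [mk_ofPath k F idx] at h0
  rw [preMap_ofPath, ← one_mul (startSum k F idx l a * _), ← sum_vertex, Finset.sum_mul]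
  refine Finset.sum_eq_zero fun v _ => ?_
  rw [← mul_assoc, vertex_mul_startSum]
  split_ifs with hv
  · refine vertex_mul_wordProd_labelSum k _ v ((length_pathWord idx p).trans_le hl) ?_
    -- The vertex `a` is kept in front of `v.word` because a relation may be a trivial path, whose
    -- word is empty and whose vanishing is visible only in the factor `vertex k a`.
    rintro ⟨u, hu⟩
    refine v.2.2 ?_
    have h := mk_vertex_mul_word k F idx l a v
    rw [if_pos hv] at h
    change v.word = 0
    rw [← h, word, ← hu, wordProd_append, ← mul_assoc, h0, zero_mul]
  · rw [zero_mul]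

variable {F} in
theorem preMap_ker (hF : ∀ p ∈ F, p.2.2.length ≤ l + 1) :
    (TwoSidedIdeal.span (ofPath k '' F)).ringCon ≤
      RingCon.ker (preMap k F idx l).toRingHom := by
  have h : TwoSidedIdeal.span (ofPath k '' F) ≤ TwoSidedIdeal.ker (preMap k F idx l) := by
    rw [TwoSidedIdeal.span_le]
    rintro _ ⟨p, hp, rfl⟩
    exact (TwoSidedIdeal.mem_ker _).2 (preMap_ofPath_of_mem k F idx l hp (hF p hp))
  intro x y hxy
  have hxy' := h ((TwoSidedIdeal.rel_iff _ _ _).1 hxy)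
  rw [TwoSidedIdeal.mem_ker, map_sub, sub_eq_zero] at hxy'
  exact hxy'

variable {F} (hF : ∀ p ∈ F, p.2.2.length ≤ l + 1)

/-- The homomorphism from the monomial algebra to the path algebra of its Ufnarovskii graph that
sends an arrow to the sum of the arrows it labels. -/
def toPathAlgebra : MonomialAlgebra k F →ₐ[k] PathAlgebra k (Graph k F idx l) :=
  RingCon.liftₐ _ (preMap k F idx l) (preMap_ker k idx l hF)

theorem toPathAlgebra_mk (x : PathAlgebra k V) :
    toPathAlgebra k idx l hF (mk k F x) = preMap k F idx l x := rfl

theorem toPathAlgebra_letter (i : I) :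
    toPathAlgebra k idx l hF (letter k F idx i) = labelSum k (letter k F idx) l i := by
  rw [letter, toPathAlgebra_mk, preMap_arrow]
  exact congrArg _ (idx.apply_symm_apply i)

theorem toPathAlgebra_wordProd (u : List I) :
    toPathAlgebra k idx l hF (wordProd (letter k F idx) u) =
      wordProd (labelSum k (letter k F idx) l) u := by
  induction u with
  | nil => rw [wordProd_nil, wordProd_nil, map_one]
  | cons i u h => rw [wordProd_cons, wordProd_cons, map_mul, h, toPathAlgebra_letter]

theorem toPathAlgebra_mem {i : ℕ} {a : MonomialAlgebra k F} (ha : a ∈ grading k F i) :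
    toPathAlgebra k idx l hF a ∈ PathAlgebra.grading k (Graph k F idx l) i := by
  obtain ⟨x, hx, rfl⟩ := ha
  change preMap k F idx l x ∈ _
  refine map_mem_of_mem_grading (preMap k F idx l) (PathAlgebra.grading k (Graph k F idx l))
    (fun a => ?_) (fun n y hy a b e => ?_) hx
  · rw [preMap_vertex]; exact startSum_mem k F idx l a
  · rw [preMap_arrow]; exact SetLike.GradedMul.mul_mem hy (labelSum_mem k _)

theorem vertex_mul_toPathAlgebra_word (v z : Graph k F idx l) :
    vertex k v * toPathAlgebra k idx l hF z.word =
      if v = z then toPathAlgebra k idx l hF v.word else 0 := by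
  rw [word, word, toPathAlgebra_wordProd, toPathAlgebra_wordProd, vertex_mul_wordProd_vertex]

theorem rep_startSum (a : V) (v z : Graph k F idx l) :
    rep k (letter k F idx) l (startSum k F idx l a) v z =
      if v = z then (if (idx.symm v.first).1 = a then 1 else 0) else 0 := by
  rw [startSum, map_sum, Matrix.sum_apply, Finset.sum_eq_single v]
  · by_cases ha : (idx.symm v.first).1 = a
    · rw [if_pos ha, if_pos ha, rep_vertex, Matrix.single_apply]
      simp only [true_and]
    · simp only [if_neg ha, map_zero, Matrix.zero_apply, ite_self]
  · intro y _ hy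
    split_ifs
    · rw [rep_vertex, Matrix.single_apply_of_row_ne hy]
    · rw [map_zero, Matrix.zero_apply]
  · simp

/-- In terms of the row vector `w` of words this is `a w = w ρ(φ a)`. Such an identity passes to
sums and products, so vertices and letters suffice. -/
theorem mul_word (a : MonomialAlgebra k F) (z : Graph k F idx l) :
    a * z.word = ∑ v : Graph k F idx l, v.word *
      rep k (letter k F idx) l (toPathAlgebra k idx l hF a) v z := by
  induction a using generator_induction idx generalizing z with
  | zero => simp
  | add a b ha hb =>
    simp only [add_mul, ha, hb, map_add, Matrix.add_apply, mul_add, Finset.sum_add_distrib]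
  | smul c a ha =>
    simp only [smul_mul_assoc, ha, map_smul, Matrix.smul_apply, mul_smul_comm, Finset.smul_sum]
  | mul a b ha hb =>
    rw [mul_assoc, hb]
    simp only [Finset.mul_sum, ← mul_assoc, ha, Finset.sum_mul, map_mul, Matrix.mul_apply]
    exact Finset.sum_comm
  | vertex a =>
    rw [toPathAlgebra_mk, preMap_vertex, mk_vertex_mul_word]
    simp only [rep_startSum, mul_ite, mul_one, mul_zero, Finset.sum_ite_eq', Finset.mem_univ,
      if_true]
  | letter i => rw [toPathAlgebra_letter, sum_word_mul_rep_labelSum]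

/-- The companion identity `b φ(w) = φ(w ρ(b))` again passes to products. For an arrow `e : v ⟶ y`,
the sum of all arrows with its label may replace `e` in front of `φ(y)`: the factor `φ(y)` starts at
the vertex `y`, which selects `e` among them. -/
theorem mul_toPathAlgebra_word (b : PathAlgebra k (Graph k F idx l)) (z : Graph k F idx l) :
    b * toPathAlgebra k idx l hF z.word = ∑ v : Graph k F idx l,
      toPathAlgebra k idx l hF (v.word * rep k (letter k F idx) l b v z) := by
  induction b using PathAlgebra.generator_induction generalizing z with
  | zero => simp
  | add a b ha hb =>
    simp only [add_mul, ha, hb, map_add, Matrix.add_apply, mul_add, Finset.sum_add_distrib]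
  | smul c a ha =>
    simp only [smul_mul_assoc, ha, map_smul, Matrix.smul_apply, mul_smul_comm, Finset.smul_sum]
  | mul a b ha hb =>
    rw [mul_assoc, hb]
    simp only [map_mul, Finset.mul_sum, ← mul_assoc, ha, Finset.sum_mul, Matrix.mul_apply, map_sum]
    exact Finset.sum_comm
  | vertex y =>
    rw [vertex_mul_toPathAlgebra_word, rep_vertex, Finset.sum_eq_single y]
    · split_ifs with h
      · subst h; rw [Matrix.single_apply_same, mul_one]
      · rw [Matrix.single_apply_of_col_ne _ _ h, mul_zero, map_zero]
    · intro v _ h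
      rw [Matrix.single_apply_of_row_ne h.symm, mul_zero, map_zero]
    · simp
  | @arrow v y e =>
    rw [← map_sum, sum_word_mul_rep_arrow, ← arrow_mul_vertex, mul_assoc,
      vertex_mul_toPathAlgebra_word]
    split_ifs with h
    · subst h
      have h := vertex_mul_toPathAlgebra_word k idx l hF y y
      rw [if_pos rfl] at h
      rw [map_mul, toPathAlgebra_letter, ← h, ← mul_assoc, ← mul_assoc, labelSum_mul_vertex,
        inArrow_label, arrow_mul_vertex]
    · rw [mul_zero, map_zero]

/-- A path of length at least `l + 1` begins with a word of exactly that length, which either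
vanishes in `A` or is a vertex of the graph. -/
theorem exists_eq_sum_word_mul {i : ℕ} {a : MonomialAlgebra k F} (hi : l + 1 ≤ i)
    (ha : a ∈ grading k F i) :
    ∃ c : Graph k F idx l → MonomialAlgebra k F, a = ∑ v : Graph k F idx l, v.word * c v := by
  obtain ⟨x, hx, rfl⟩ := ha
  change ∃ c : Graph k F idx l → MonomialAlgebra k F, mk k F x = _
  induction hx using Submodule.span_induction with
  | zero => exact ⟨0, by simp⟩
  | add x y _ _ hx hy =>
    obtain ⟨c, hc⟩ := hx
    obtain ⟨d, hd⟩ := hy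
    exact ⟨c + d, by simp only [map_add, hc, hd, Pi.add_apply, mul_add, Finset.sum_add_distrib]⟩
  | smul r x _ hx =>
    obtain ⟨c, hc⟩ := hx
    exact ⟨r • c, by simp only [map_smul, hc, Pi.smul_apply, mul_smul_comm, Finset.smul_sum]⟩
  | mem x hx =>
    obtain ⟨⟨a, b, p⟩, hp, rfl⟩ := hx
    change p.length = i at hp
    rw [mk_ofPath k F idx, ← List.take_append_drop (l + 1) (pathWord idx p), wordProd_append,
      ← mul_assoc]
    by_cases h : wordProd (letter k F idx) ((pathWord idx p).take (l + 1)) = 0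
    · exact ⟨0, by simp [h]⟩
    · let v : Graph k F idx l := ⟨(pathWord idx p).take (l + 1), by
        rw [List.length_take, length_pathWord]; omega, h⟩
      have hv := mk_vertex_mul_word k F idx l a v
      change ∃ c : Graph k F idx l → MonomialAlgebra k F, mk k F (vertex k a) * v.word * _ = _
      rw [hv]
      split_ifs
      · refine ⟨Pi.single v (wordProd (letter k F idx) ((pathWord idx p).drop (l + 1))), ?_⟩
        rw [Finset.sum_eq_single v, Pi.single_eq_same]
        · exact fun z _ hz => by rw [Pi.single_eq_of_ne hz, mul_zero]
        · simp
      · exact ⟨0, by simp⟩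

/-- A path is determined by its labels and its end `z`, so it equals `φ` of the product of its
labels, cut down by the vertex `z`. -/
theorem mem_span_toPathAlgebra_mul {i : ℕ} {b : PathAlgebra k (Graph k F idx l)}
    (hb : b ∈ PathAlgebra.grading k (Graph k F idx l) i) :
    b ∈ Submodule.span k {x | ∃ a ∈ grading k F i, ∃ c, x = toPathAlgebra k idx l hF a * c} := by
  refine Submodule.span_mono ?_ hb
  rintro _ ⟨⟨v, z, p⟩, rfl, rfl⟩
  suffices h : ∃ a ∈ grading k F p.length,
      ofPath k ⟨v, z, p⟩ = toPathAlgebra k idx l hF a * vertex k z by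
    obtain ⟨a, ha, h⟩ := h
    exact ⟨a, ha, _, h⟩
  clear hb
  induction p with
  | nil => exact ⟨1, SetLike.GradedOne.one_mem, by rw [map_one, one_mul]; rfl⟩
  | cons p e h =>
    obtain ⟨a, ha, h⟩ := h
    refine ⟨a * letter k F idx (label e), SetLike.GradedMul.mul_mem ha (letter_mem k F idx _), ?_⟩
    rw [ofPath_cons, h, mul_assoc, vertex_mul_arrow, map_mul, toPathAlgebra_letter, mul_assoc,
      labelSum_mul_vertex, inArrow_label]

/-- The datum comparing a monomial algebra with the path algebra of its Ufnarovskii graph. -/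
def transferDatum : TransferDatum (grading k F) (PathAlgebra.grading k (Graph k F idx l))
    (Graph k F idx l) where
  map := toPathAlgebra k idx l hF
  map_mem := toPathAlgebra_mem k idx l hF
  rep := rep k (letter k F idx) l
  rep_mem := rep_mem k l (letter_mem k F idx)
  len := l + 1
  word := word
  word_mem := word_mem k l (letter_mem k F idx)
  vertex := vertex k
  vertex_mul_map_word := vertex_mul_toPathAlgebra_word k idx l hF
  rep_vertex := rep_vertex k (letter k F idx) l
  word_mul_rep := word_mul_rep k l (letter_mem k F idx)
  mul_word := mul_word k idx l hF
  mul_map_word := mul_toPathAlgebra_word k idx l hF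
  exists_eq_sum := exists_eq_sum_word_mul k idx l
  mem_span := mem_span_toPathAlgebra_mul k idx l hF

end MonomialAlgebra

end

theorem theorem1p1 (k : Type u) [Field k] {V : Type v} [Quiver.{w} V] [Finite V]
    [∀ a b : V, Finite (a ⟶ b)] (F : Set (QuiverPath V)) (hF : F.Finite) :
    ∃ (W : Type) (_ : Quiver.{0} W) (_ : Finite W) (_ : ∀ a b : W, Finite (a ⟶ b)),
      Nonempty (QGr.{max u v w t} (MonomialAlgebra.grading k F) ≌
        QGr.{max u v w t} (PathAlgebra.grading k W)) := by
  classical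
  have := Fintype.ofFinite V
  -- Numbering the arrows by `Fin n` puts words, and hence the new quiver, in `Type`.
  obtain ⟨n, ⟨idx⟩⟩ := Finite.exists_equiv_fin (Σ a b : V, a ⟶ b)
  -- Here `l` bounds the lengths of the relations. Words of length `l + 1` are more than long
  -- enough, and are never empty, so every vertex has a first letter.
  obtain ⟨l, hl⟩ := (hF.image fun p => p.2.2.length).bddAbove
  exact ⟨MonomialAlgebra.Graph k F idx l, inferInstance, inferInstance, inferInstance,
    (MonomialAlgebra.transferDatum k idx l fun p hp =>
      (hl ⟨p, hp, rfl⟩).trans (Nat.le_succ l)).nonempty_qGr_equivalence⟩
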